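/- Let $N\ge 3$ be an integer and let $p\in\mathbb R$ satisfy $2\le p<N$ and $p\le \frac{2N}{N-2}$. Let $\sigma_1\in\mathbb R$ satisfy $1-\frac N2<\sigma_1\le \frac{2N}{p}-\frac N2$, and let $k_0\in\mathbb Z$. Fix a radial $\varphi\in\mathcal S(\mathbb R^N)$ supported in $\{\frac34\le|\xi|\le\frac83\}$ with $\sum_{j\in\mathbb Z}\varphi(2^{-j}\xi)=1$ for all $\xi\neq0$, and let $\dot\Delta_j u=\mathcal F^{-1}\big(\varphi(2^{-j}\cdot)\mathcal F u\big)$. For a tempered distribution $u$ on $\mathbb R^N$ (taken modulo polynomials), $s\in\mathbb R$ and $1\le q,r\le\infty$, put $$\|u\|_{\dot B^s_{q,r}}=\big\|\big(2^{ks}\|\dot\Delta_k u\|_{L^q}\big)_{k\in\mathbb Z}\big\|_{\ell^r},\qquad \|u\|^{\ell}_{\dot B^s_{q,r}}=\big\|\big(2^{ks}\|\dot\Delta_k u\|_{L^q}\big)_{k\le k_0}\big\|_{\ell^r},$$ and let $u\in\dot B^s_{q,r}$ mean $\|u\|_{\dot B^s_{q,r}}<\infty$. The product of $f$ and $g$ is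 $fg=\sum_{k,k'\in\mathbb Z}\dot\Delta_kf\,\dot\Delta_{k'}g$, whenever this double series of functions converges unconditionally in $\mathcal S'(\mathbb R^N)$; grouping its terms gives Bony's decomposition $fg=T_fg+T_gf+R(f,g)$. Then there is a constant $C$, depending only on $N,p,\sigma_1,\varphi,k_0$, such that the following holds for all $f,g$ for which the Besov norms on the right-hand side are finite; in each case the product on the left-hand side exists. 1. $\displaystyle \|fg\|_{\dot B^{-\sigma_1}_{2,\infty}}\le C\,\|f\|_{\dot B^{N/p}_{p,1}}\|g\|_{\dot B^{-\sigma_1}_{2,\infty}}$; 2. $\displaystyle \|fg\|^{\ell}_{\dot B^{-\sigma_1}_{2,\infty}}\le C\,\|f\|_{\dot B^{N/p-1}_{p,1}}\Big(\|g\|_{\dot B^{-\sigma_1+N/p-N/2+1}_{p,\infty}}+\|g\|_{\dot B^{-\sigma_1+2N/p-N+1}_{p,\infty}}\Big)$; 3. $\displaystyle \|fg\|^{\ell}_{\dot B^{-\sigma_1}_{2,\infty}}\le C\,\|f\|_{\dot B^{N/p-2}_{p,1}}\Big(\|g\|_{\dot B^{-\sigma_1+N/p-N/2+2}_{p,\infty}}+\|g\|_{\dot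 B^{-\sigma_1+2N/p-N+1}_{p,\infty}}\Big)$. If $f=g$, the low-frequency restriction and the second norm can be dropped in 3 and 2: 4. $\displaystyle \|ff\|_{\dot B^{-\sigma_1}_{2,\infty}}\le C\,\|f\|_{\dot B^{N/p-2}_{p,1}}\|f\|_{\dot B^{-\sigma_1+N/p-N/2+2}_{p,\infty}}$; 5. $\displaystyle \|ff\|_{\dot B^{-\sigma_1}_{2,\infty}}\le C\,\|f\|_{\dot B^{N/p-1}_{p,1}}\|f\|_{\dot B^{-\sigma_1+N/p-N/2+1}_{p,\infty}}$. -/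

import Mathlib

open MeasureTheory
open scoped ENNReal NNReal SchwartzMap

noncomputable section

namespace LittlewoodPaley

/-- `ℝ^N` with the Euclidean norm and Lebesgue measure. -/
abbrev RN (N : ℕ) : Type := EuclideanSpace ℝ (Fin N)

/-- A generator of a homogeneous dyadic partition of unity: a radial Schwartz function, supported
in the annulus `3/4 ≤ |ξ| ≤ 8/3`, with `∑_{j ∈ ℤ} φ(2^{-j} ξ) = 1` for `ξ ≠ 0`. -/
structure IsDyadicGenerator {N : ℕ} (φ : 𝓢(RN N, ℂ)) : Prop where
  radial : ∀ ξ η : RN N, ‖ξ‖ = ‖η‖ → φ ξ = φ η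
  support : Function.support φ ⊆ {ξ : RN N | 3 / 4 ≤ ‖ξ‖ ∧ ‖ξ‖ ≤ 8 / 3}
  partition : ∀ ξ : RN N, ξ ≠ 0 → HasSum (fun j : ℤ => φ ((2 : ℝ) ^ (-j) • ξ)) 1

/-- The homogeneous frequency localization operator `Δ̇_j` on tempered distributions: the Fourier
multiplier with symbol `ξ ↦ φ(2^{-j} ξ)`, where the Fourier transform is normalized with the kernel
`e^{-2π i x·ξ}`. -/
def dyadicBlock {N : ℕ} (φ : 𝓢(RN N, ℂ)) (j : ℤ) : 𝓢'(RN N, ℂ) →L[ℂ] 𝓢'(RN N, ℂ) :=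
  TemperedDistribution.fourierMultiplierCLM ℂ (fun ξ : RN N => φ ((2 : ℝ) ^ (-j) • ξ))

/-- The tempered distribution `u` is (given by integration against) the function `h`. -/
structure IsGivenBy {N : ℕ} (u : 𝓢'(RN N, ℂ)) (h : RN N → ℂ) : Prop where
  locallyIntegrable : LocallyIntegrable h
  integrable : ∀ ψ : 𝓢(RN N, ℂ), Integrable (fun x => ψ x * h x)
  apply_eq : ∀ ψ : 𝓢(RN N, ℂ), u ψ = ∫ x, ψ x * h x

/-- The function that gives a tempered distribution is unique almost everywhere. -/
theorem IsGivenBy.ae_eq {N : ℕ} {u : 𝓢'(RN N, ℂ)} {h₁ h₂ : RN N → ℂ}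
    (H₁ : IsGivenBy u h₁) (H₂ : IsGivenBy u h₂) : h₁ =ᵐ[volume] h₂ := by
  refine ae_eq_of_integral_contDiff_smul_eq H₁.locallyIntegrable H₂.locallyIntegrable ?_
  intro g hg hgc
  have hc : HasCompactSupport (Complex.ofRealCLM ∘ g) := hgc.comp_left rfl
  have e₁ := H₁.apply_eq (hc.toSchwartzMap (by fun_prop))
  have e₂ := H₂.apply_eq (hc.toSchwartzMap (by fun_prop))
  simpa using e₁.symm.trans e₂

/-- The `L^p` norm of a tempered distribution: the norm of the function that gives it, and `∞` if
there is none. -/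
def lpNorm {N : ℕ} (p : ℝ≥0∞) (u : 𝓢'(RN N, ℂ)) : ℝ≥0∞ :=
  ⨅ (h : RN N → ℂ) (_ : IsGivenBy u h), eLpNorm h p volume

/-- The homogeneous Besov norm `‖ 2^{ks} ‖Δ̇_k u‖_{L^p} ‖_{ℓ^r(ℤ)}`. Adding a polynomial to `u`
changes no `Δ̇_k u`, so this is a function of the class of `u` modulo polynomials. -/
def besovNorm {N : ℕ} (φ : 𝓢(RN N, ℂ)) (s : ℝ) (p r : ℝ≥0∞) (u : 𝓢'(RN N, ℂ)) : ℝ≥0∞ :=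
  eLpNorm (fun k : ℤ => (2 : ℝ≥0∞) ^ ((k : ℝ) * s) * lpNorm p (dyadicBlock φ k u)) r Measure.count

/-- The low-frequency part of the Besov norm: only the blocks with `k ≤ k₀` are counted. -/
def besovNormLow {N : ℕ} (φ : 𝓢(RN N, ℂ)) (k₀ : ℤ) (s : ℝ) (p r : ℝ≥0∞) (u : 𝓢'(RN N, ℂ)) :
    ℝ≥0∞ :=
  eLpNorm (fun k : ℤ =>
    if k ≤ k₀ then (2 : ℝ≥0∞) ^ ((k : ℝ) * s) * lpNorm p (dyadicBlock φ k u) else 0) r Measure.count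

/-- Membership in the homogeneous Besov space `Ḃ^s_{p,r}`, for a representative modulo
polynomials. -/
def MemBesov {N : ℕ} (φ : 𝓢(RN N, ℂ)) (s : ℝ) (p r : ℝ≥0∞) (u : 𝓢'(RN N, ℂ)) : Prop :=
  besovNorm φ s p r u < ∞

/-- `w` is the product `f g` of two tempered distributions modulo polynomials: the functions
`Δ̇_k f` and `Δ̇_l g` are multiplied pointwise, and `∑_{k, l} Δ̇_k f Δ̇_l g` converges
(unconditionally) to `w` in the space of tempered distributions. Grouping the pairs with
`k ≤ l - 2`, `l ≤ k - 2` and `|k - l| ≤ 1` gives the paraproducts `T_f g`, `T_g f` and the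
remainder `R(f, g)` of Bony's decomposition. -/
def IsProduct {N : ℕ} (φ : 𝓢(RN N, ℂ)) (f g w : 𝓢'(RN N, ℂ)) : Prop :=
  ∃ (F G : ℤ → RN N → ℂ) (P : ℤ × ℤ → 𝓢'(RN N, ℂ)),
    (∀ k, IsGivenBy (dyadicBlock φ k f) (F k)) ∧
    (∀ l, IsGivenBy (dyadicBlock φ l g) (G l)) ∧
    (∀ q, IsGivenBy (P q) (fun x => F q.1 x * G q.2 x)) ∧
    HasSum P w

/-- The product is unique. -/
theorem IsProduct.unique {N : ℕ} {φ : 𝓢(RN N, ℂ)} {f g w₁ w₂ : 𝓢'(RN N, ℂ)}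
    (H₁ : IsProduct φ f g w₁) (H₂ : IsProduct φ f g w₂) : w₁ = w₂ := by
  obtain ⟨F₁, G₁, P₁, hF₁, hG₁, hP₁, hw₁⟩ := H₁
  obtain ⟨F₂, G₂, P₂, hF₂, hG₂, hP₂, hw₂⟩ := H₂
  have hP : P₁ = P₂ := by
    funext q
    ext ψ
    rw [(hP₁ q).apply_eq, (hP₂ q).apply_eq]
    refine integral_congr_ae ?_
    filter_upwards [(hF₁ q.1).ae_eq (hF₂ q.1), (hG₁ q.2).ae_eq (hG₂ q.2)] with x hx hy
    rw [hx, hy]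
  subst hP
  exact hw₁.unique hw₂

end LittlewoodPaley

end

/-! The product is estimated piece by piece, following Bony. Let `F k`, `G l` be the functions
giving the blocks of f and g, and put ω = N(1/p + 1/q - 1/2), where f is measured in L^p and g in
L^q. By Hölder and Bernstein, the L^2 norm of `F k * G l` is at most 2^{kω} ‖F k‖_p ‖G l‖_q, or the
same with 2^{lω}; the factor with the lower frequency is the one to pay
(`exists_eLpNorm_mul_two_le`).

Three sums result. For k below l, the ℓ^1 summability of f gives 2^{l(ω-α-β)} as soon as α ≤ ω
(`exists_tsum_low_le`). For l below k, g is only ℓ^∞, so a geometric series is needed, hence β' < ω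
strictly, and the outcome is 2^{k(ω-β'-α)} (`exists_tsum_high_le`). Comparable frequencies are put
in L^r with 1/r = 1/p + 1/q and summed using α + β ≥ 0 (`exists_tsum_diag_le`); Bernstein from L^r
to L^2 is applied only after localization at 2^j.

Spectral localization turns these sums into block bounds with exponents σ = ω-α-β and τ = ω-β'-α
(`exists_product_bound`). If τ ≥ σ, the second term is harmless for j ≤ k₀, which explains the
low-frequency norms. For a square, the two paraproducts coincide and only σ appears.

The double series converges in the space of tempered distributions because test functions supply
summable weights (`ProductBounds.exists_isProduct`): Bernstein gives 2^{lN/2} at low frequency, the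
decay of the Fourier transform gives any negative power of 2^l on separated high frequencies, and
comparable high frequencies are already summable in L^r. -/

noncomputable section

namespace LittlewoodPaley

open FourierTransform

/-! ### Jensen's inequality and interpolation of Lebesgue norms -/

section Lintegral

variable {α : Type*} [MeasurableSpace α] {μ : Measure α}

/-- Jensen's inequality for the measure with density `k`, in Hölder form. -/
theorem lintegral_mul_rpow_le {k h : α → ℝ≥0∞} (hk : AEMeasurable k μ) (hh : AEMeasurable h μ)
    {a : ℝ} (ha : 1 ≤ a) :
    (∫⁻ x, k x * h x ∂μ) ^ a ≤ (∫⁻ x, k x ∂μ) ^ (a - 1) * ∫⁻ x, k x * h x ^ a ∂μ := by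
  have ha0 : 0 < a := by linarith
  -- Hölder for the factorization k h = k^{1-1/a} (k h^a)^{1/a}.
  have key := ENNReal.lintegral_mul_norm_pow_le (μ := μ) hk (hk.mul (hh.pow_const a))
    (p := 1 - a⁻¹) (q := a⁻¹) (by simpa using inv_le_one_of_one_le₀ ha) (by positivity) (by ring)
  have e : ∀ x, k x ^ (1 - a⁻¹) * ((k * fun x => h x ^ a) x) ^ a⁻¹ = k x * h x := by
    intro x
    rw [Pi.mul_apply, ENNReal.mul_rpow_of_nonneg _ _ (by positivity), ← mul_assoc,
      ← ENNReal.rpow_add_of_nonneg _ _ (by simpa using inv_le_one_of_one_le₀ ha) (by positivity),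
      ← ENNReal.rpow_mul, mul_inv_cancel₀ ha0.ne']
    simp
  simp_rw [e] at key
  calc (∫⁻ x, k x * h x ∂μ) ^ a
      ≤ ((∫⁻ x, k x ∂μ) ^ (1 - a⁻¹) * (∫⁻ x, k x * h x ^ a ∂μ) ^ a⁻¹) ^ a :=
        ENNReal.rpow_le_rpow key ha0.le
    _ = _ := by
        rw [ENNReal.mul_rpow_of_nonneg _ _ ha0.le, ← ENNReal.rpow_mul, ← ENNReal.rpow_mul,
          inv_mul_cancel₀ ha0.ne', ENNReal.rpow_one]
        congr 2
        field_simp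

/-- Interpolation of an `L^b` norm between `L^a` and a uniform bound. -/
theorem eLpNorm_le_of_enorm_le {u : α → ℂ} {a : ℝ} (ha : 1 ≤ a) {b : ℝ≥0∞}
    (hab : ENNReal.ofReal a ≤ b) {A D : ℝ≥0∞} (hA : ∫⁻ x, ‖u x‖ₑ ^ a ∂μ ≤ A)
    (hD : ∀ x, ‖u x‖ₑ ≤ D)
    (hD' : D ≠ ∞) :
    eLpNorm u b μ ≤ A ^ b.toReal⁻¹ * D ^ (1 - a * b.toReal⁻¹) := by
  have ha0 : 0 < a := by linarith
  rcases eq_or_ne b ∞ with rfl | hb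
  · simpa using eLpNormEssSup_le_of_ae_enorm_bound (Filter.Eventually.of_forall hD)
  have hb0 : b ≠ 0 := by
    rintro rfl
    simp at hab
    linarith
  have hab' : a ≤ b.toReal := (ENNReal.ofReal_le_iff_le_toReal hb).1 hab
  have hbp : 0 < b.toReal := by linarith
  rw [eLpNorm_eq_lintegral_rpow_enorm_toReal hb0 hb, one_div]
  calc (∫⁻ x, ‖u x‖ₑ ^ b.toReal ∂μ) ^ b.toReal⁻¹
      ≤ (∫⁻ x, ‖u x‖ₑ ^ a * D ^ (b.toReal - a) ∂μ) ^ b.toReal⁻¹ := by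
        refine ENNReal.rpow_le_rpow (lintegral_mono fun x => ?_) (by positivity)
        calc ‖u x‖ₑ ^ b.toReal = ‖u x‖ₑ ^ a * ‖u x‖ₑ ^ (b.toReal - a) := by
              rw [← ENNReal.rpow_add_of_nonneg _ _ ha0.le (by linarith)]
              congr 1
              ring
          _ ≤ _ := by
              gcongr
              exact hD x
    _ ≤ (A * D ^ (b.toReal - a)) ^ b.toReal⁻¹ := by
        refine ENNReal.rpow_le_rpow ?_ (by positivity)
        rw [lintegral_mul_const' _ _ (ENNReal.rpow_ne_top_of_nonneg (by linarith) hD')]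
        gcongr
    _ = _ := by
        rw [ENNReal.mul_rpow_of_nonneg _ _ (by positivity), ← ENNReal.rpow_mul]
        congr 2
        field_simp

end Lintegral

/-! ### Young's inequality for Schwartz kernels -/

section Kernel

variable {N : ℕ}

/-- Convolution of a function with the reflection of a Schwartz kernel. -/
def kernelConv (κ : 𝓢(RN N, ℂ)) (h : RN N → ℂ) (y : RN N) : ℂ := ∫ x, κ (x - y) * h x

theorem lintegral_kernel_rpow_le (κ : 𝓢(RN N, ℂ)) {h : RN N → ℂ}
    (hh : AEStronglyMeasurable h volume) {a : ℝ} (ha : 1 ≤ a) (y : RN N) :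
    (∫⁻ x, ‖κ (x - y)‖ₑ * ‖h x‖ₑ) ^ a ≤
      (∫⁻ x, ‖κ x‖ₑ) ^ (a - 1) * ∫⁻ x, ‖κ (x - y)‖ₑ * ‖h x‖ₑ ^ a := by
  have := lintegral_mul_rpow_le (μ := volume) (k := fun x => ‖κ (x - y)‖ₑ) (h := fun x => ‖h x‖ₑ)
    (by have := κ.continuous; fun_prop) hh.enorm ha
  rwa [lintegral_sub_right_eq_self (fun x => ‖κ x‖ₑ) y] at this

theorem lintegral_kernel_lt_top (κ : 𝓢(RN N, ℂ)) : ∫⁻ x, ‖κ x‖ₑ < ∞ := κ.integrable.2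

theorem exists_kernel_bound (κ : 𝓢(RN N, ℂ)) : ∃ K : ℝ≥0, ∀ x, ‖κ x‖ₑ ≤ K := by
  obtain ⟨C, hC, h⟩ := κ.decay 0 0
  refine ⟨C.toNNReal, fun x => ?_⟩
  have := h x
  simp only [pow_zero, norm_iteratedFDeriv_zero, one_mul] at this
  rw [← ofReal_norm]
  exact ENNReal.ofReal_le_ofReal this

theorem lintegral_enorm_rpow_eq {h : RN N → ℂ} {a : ℝ} (ha : 1 ≤ a) :
    (∫⁻ x, ‖h x‖ₑ ^ a) ^ a⁻¹ = eLpNorm h (ENNReal.ofReal a) volume := by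
  rw [eLpNorm_eq_lintegral_rpow_enorm_toReal (by simp; linarith) (by simp),
    ENNReal.toReal_ofReal (by linarith), one_div]

/-- Jensen with the kernel as weight leaves one copy of the kernel under the integral, and the
uniform bound removes it. This is the L^a to L^∞ endpoint of Young's inequality. -/
theorem lintegral_kernel_le (κ : 𝓢(RN N, ℂ)) {K : ℝ≥0∞} (hK : ∀ x, ‖κ x‖ₑ ≤ K) {h : RN N → ℂ}
    (hh : AEStronglyMeasurable h volume) {a : ℝ} (ha : 1 ≤ a) (y : RN N) :
    ∫⁻ x, ‖κ (x - y)‖ₑ * ‖h x‖ₑ ≤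
      ((∫⁻ x, ‖κ x‖ₑ) ^ (a - 1) * (K * ∫⁻ x, ‖h x‖ₑ ^ a)) ^ a⁻¹ := by
  have ha0 : 0 < a := by linarith
  rw [ENNReal.le_rpow_inv_iff ha0]
  refine (lintegral_kernel_rpow_le κ hh ha y).trans ?_
  gcongr
  calc ∫⁻ x, ‖κ (x - y)‖ₑ * ‖h x‖ₑ ^ a ≤ ∫⁻ x, K * ‖h x‖ₑ ^ a := by
        gcongr with x
        exact hK _
    _ = _ := lintegral_const_mul'' _ (hh.enorm.pow_const a)

theorem aestronglyMeasurable_kernel (κ : 𝓢(RN N, ℂ)) {h : RN N → ℂ}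
    (hh : AEStronglyMeasurable h volume) :
    AEStronglyMeasurable (fun z : RN N × RN N => κ (z.2 - z.1) * h z.2)
      (volume.prod volume) := by
  refine AEStronglyMeasurable.mul ?_ hh.comp_snd
  exact (κ.continuous.comp (by fun_prop)).aestronglyMeasurable

theorem aestronglyMeasurable_kernelConv (κ : 𝓢(RN N, ℂ)) {h : RN N → ℂ}
    (hh : AEStronglyMeasurable h volume) : AEStronglyMeasurable (kernelConv κ h) volume :=
  (aestronglyMeasurable_kernel κ hh).integral_prod_right'

theorem enorm_kernelConv_le (κ : 𝓢(RN N, ℂ)) (h : RN N → ℂ) (y : RN N) :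
    ‖kernelConv κ h y‖ₑ ≤ ∫⁻ x, ‖κ (x - y)‖ₑ * ‖h x‖ₑ := by
  refine (enorm_integral_le_lintegral_enorm _).trans ?_
  simp

/-- Young's inequality, in terms of the `L^1` norm and a uniform bound of the kernel. -/
theorem eLpNorm_kernelConv_le (κ : 𝓢(RN N, ℂ)) {K : ℝ≥0} (hK : ∀ x, ‖κ x‖ₑ ≤ K) {h : RN N → ℂ}
    {a : ℝ} (ha : 1 ≤ a) (hh : MemLp h (ENNReal.ofReal a) volume) {b : ℝ≥0∞}
    (hab : ENNReal.ofReal a ≤ b) :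
    eLpNorm (kernelConv κ h) b volume ≤
      (∫⁻ x, ‖κ x‖ₑ) ^ (1 - (a⁻¹ - b.toReal⁻¹)) * (K : ℝ≥0∞) ^ (a⁻¹ - b.toReal⁻¹) *
        eLpNorm h (ENNReal.ofReal a) volume := by
  have ha0 : 0 < a := by linarith
  set K₁ := ∫⁻ x, ‖κ x‖ₑ with hK₁
  have hK₁t : K₁ ≠ ∞ := (lintegral_kernel_lt_top κ).ne
  set H := ∫⁻ x, ‖h x‖ₑ ^ a with hH
  have hHt : H ≠ ∞ := by
    have := hh.2
    rw [← lintegral_enorm_rpow_eq ha] at this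
    intro h'
    rw [← hH, h', ENNReal.top_rpow_of_pos (by positivity)] at this
    exact lt_irrefl _ this
  -- Two endpoints are enough: `h1` is the uniform bound and `h2` the L^a bound, from Jensen and
  -- Tonelli. Every b between a and ∞ follows by interpolation; the rest is bookkeeping of
  -- exponents.
  have h1 : ∀ y, ‖kernelConv κ h y‖ₑ ≤ (K₁ ^ (a - 1) * (K * H)) ^ a⁻¹ := fun y =>
    (enorm_kernelConv_le κ h y).trans (lintegral_kernel_le κ hK hh.1 ha y)
  have hm : AEMeasurable (fun z : RN N × RN N => ‖κ (z.2 - z.1)‖ₑ * ‖h z.2‖ₑ ^ a)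
      (volume.prod volume) := by
    refine AEMeasurable.mul ?_ ((hh.1.comp_snd (μ := volume)).enorm.pow_const a)
    exact (κ.continuous.comp (by fun_prop)).aestronglyMeasurable.enorm
  have h2 : ∫⁻ y, ‖kernelConv κ h y‖ₑ ^ a ≤ K₁ ^ a * H := by
    calc ∫⁻ y, ‖kernelConv κ h y‖ₑ ^ a
        ≤ ∫⁻ y, K₁ ^ (a - 1) * ∫⁻ x, ‖κ (x - y)‖ₑ * ‖h x‖ₑ ^ a := by
          refine lintegral_mono fun y => ?_
          exact (ENNReal.rpow_le_rpow (enorm_kernelConv_le κ h y) ha0.le).trans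
            (lintegral_kernel_rpow_le κ hh.1 ha y)
      _ = K₁ ^ (a - 1) * ∫⁻ y, ∫⁻ x, ‖κ (x - y)‖ₑ * ‖h x‖ₑ ^ a :=
          lintegral_const_mul' _ _ (ENNReal.rpow_ne_top_of_nonneg (by linarith) hK₁t)
      _ = K₁ ^ (a - 1) * ∫⁻ x, ∫⁻ y, ‖κ (x - y)‖ₑ * ‖h x‖ₑ ^ a := by
          rw [lintegral_lintegral_swap hm]
      _ = K₁ ^ (a - 1) * ∫⁻ x, K₁ * ‖h x‖ₑ ^ a := by
          congr 2
          funext x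
          rw [lintegral_mul_const _ (by have := κ.continuous.measurable; fun_prop),
            lintegral_sub_left_eq_self (fun z => ‖κ z‖ₑ) x]
      _ = K₁ ^ (a - 1) * (K₁ * H) := by rw [lintegral_const_mul' _ _ hK₁t]
      _ = K₁ ^ a * H := by
          rw [← mul_assoc]
          congr 1
          nth_rw 2 [← ENNReal.rpow_one K₁]
          rw [← ENNReal.rpow_add_of_nonneg _ _ (by linarith) (by norm_num)]
          congr 1
          ring
  have hD : (K₁ ^ (a - 1) * (K * H)) ^ a⁻¹ ≠ ∞ := by
    refine ENNReal.rpow_ne_top_of_nonneg (by positivity) ?_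
    exact ENNReal.mul_ne_top (ENNReal.rpow_ne_top_of_nonneg (by linarith) hK₁t)
      (ENNReal.mul_ne_top ENNReal.coe_ne_top hHt)
  refine (eLpNorm_le_of_enorm_le ha hab h2 h1 hD).trans (le_of_eq ?_)
  have hb1 : b.toReal⁻¹ ≤ a⁻¹ := by
    rcases eq_or_ne b ∞ with rfl | hb
    · simpa using ha0.le
    · exact inv_anti₀ ha0 ((ENNReal.ofReal_le_iff_le_toReal hb).1 hab)
  have hb0 : 0 ≤ b.toReal⁻¹ := by positivity
  have ha1 : a⁻¹ ≤ 1 := inv_le_one_of_one_le₀ ha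
  rw [← lintegral_enorm_rpow_eq ha, ← hH]
  set β := b.toReal⁻¹
  have e1 : 0 ≤ 1 - a * β := by
    have : a * β ≤ a * a⁻¹ := by gcongr
    rw [mul_inv_cancel₀ ha0.ne'] at this
    linarith
  have e2 : a⁻¹ * (1 - a * β) = a⁻¹ - β := by field_simp
  have e3 : 0 ≤ (a - 1) * (a⁻¹ - β) := mul_nonneg (by linarith) (by linarith)
  rw [← ENNReal.rpow_mul, e2, ENNReal.mul_rpow_of_nonneg _ _ hb0,
    ENNReal.mul_rpow_of_nonneg _ _ (by linarith : 0 ≤ a⁻¹ - β),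
    ENNReal.mul_rpow_of_nonneg _ _ (by linarith : 0 ≤ a⁻¹ - β),
    ← ENNReal.rpow_mul, ← ENNReal.rpow_mul]
  have e4 : K₁ ^ (1 - (a⁻¹ - β)) = K₁ ^ (a * β) * K₁ ^ ((a - 1) * (a⁻¹ - β)) := by
    rw [← ENNReal.rpow_add_of_nonneg _ _ (by positivity) e3]
    congr 1
    field_simp
    ring
  have e5 : H ^ a⁻¹ = H ^ β * H ^ (a⁻¹ - β) := by
    rw [← ENNReal.rpow_add_of_nonneg _ _ hb0 (by linarith)]
    congr 1
    ring
  rw [e4, e5]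
  ring

end Kernel

/-! ### Dyadic dilation of symbols and Bernstein's inequality -/

section Dilation

variable {N : ℕ}

/-- The dilate `ξ ↦ m (2^{-j} ξ)` of a Schwartz function. -/
def dilate (j : ℤ) (m : 𝓢(RN N, ℂ)) : 𝓢(RN N, ℂ) :=
  SchwartzMap.compCLMOfContinuousLinearEquiv ℂ
    (ContinuousLinearEquiv.smulLeft (Units.mk0 ((2 : ℝ) ^ (-j)) (by positivity))) m

@[simp]
theorem dilate_apply (j : ℤ) (m : 𝓢(RN N, ℂ)) (ξ : RN N) :
    dilate j m ξ = m ((2 : ℝ) ^ (-j) • ξ) := rfl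

theorem fourier_dilate_apply (j : ℤ) (m : 𝓢(RN N, ℂ)) (x : RN N) :
    (𝓕 (dilate j m)) x = ((2 : ℂ) ^ j) ^ N * (𝓕 m) ((2 : ℝ) ^ j • x) := by
  rw [SchwartzMap.fourier_coe, SchwartzMap.fourier_coe, Real.fourier_eq, Real.fourier_eq]
  have := Measure.integral_comp_smul (volume : Measure (RN N))
    (fun v => (Real.fourierChar (-inner ℝ v ((2 : ℝ) ^ j • x))) • m v) ((2 : ℝ) ^ (-j))
  have e : ∀ v : RN N, inner ℝ ((2 : ℝ) ^ (-j) • v) ((2 : ℝ) ^ j • x) = inner ℝ v x := by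
    intro v
    rw [real_inner_smul_left, real_inner_smul_right, ← mul_assoc, ← zpow_add₀ (by norm_num)]
    simp
  simp only [e] at this
  simp only [dilate_apply]
  rw [this, finrank_euclideanSpace_fin]
  simp [zpow_neg]

theorem enorm_fourier_dilate (j : ℤ) (m : 𝓢(RN N, ℂ)) (x : RN N) :
    ‖(𝓕 (dilate j m)) x‖ₑ = (2 : ℝ≥0∞) ^ ((j : ℝ) * N) * ‖(𝓕 m) ((2 : ℝ) ^ j • x)‖ₑ := by
  rw [fourier_dilate_apply, enorm_mul, enorm_pow]
  congr 1
  rw [ENNReal.rpow_mul, ENNReal.rpow_natCast]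
  congr 1
  rw [← ofReal_norm, norm_zpow, ← Real.rpow_intCast, ← ENNReal.ofReal_rpow_of_pos (by norm_num)]
  simp

/-- The factor 2^{jN} of the dilated kernel cancels the Jacobian. In Young's inequality the
dependence on j therefore comes from the uniform bound alone. -/
theorem lintegral_fourier_dilate (j : ℤ) (m : 𝓢(RN N, ℂ)) :
    ∫⁻ x, ‖(𝓕 (dilate j m)) x‖ₑ = ∫⁻ x, ‖(𝓕 m) x‖ₑ := by
  have hm : Measurable fun x : RN N => ‖(𝓕 m) x‖ₑ := (𝓕 m).continuous.measurable.enorm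
  have hr : (2 : ℝ) ^ j ≠ 0 := by positivity
  have key := lintegral_map (μ := volume) hm (measurable_const_smul ((2 : ℝ) ^ j))
  rw [Measure.map_addHaar_smul _ hr, lintegral_smul_measure, finrank_euclideanSpace_fin] at key
  simp_rw [enorm_fourier_dilate]
  rw [lintegral_const_mul' _ _ (by simp), ← key, smul_eq_mul, ← mul_assoc]
  have : (2 : ℝ≥0∞) ^ ((j : ℝ) * N) * ENNReal.ofReal |(((2 : ℝ) ^ j) ^ N)⁻¹| = 1 := by
    have e : |(((2 : ℝ) ^ j) ^ N)⁻¹| = (2 : ℝ) ^ (-((j : ℝ) * N)) := by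
      rw [abs_of_pos (by positivity), Real.rpow_neg (by norm_num), Real.rpow_mul (by norm_num),
        Real.rpow_natCast, Real.rpow_intCast]
    rw [e, ← ENNReal.ofReal_rpow_of_pos (by norm_num), ENNReal.ofReal_ofNat,
      ← ENNReal.rpow_add _ _ (by norm_num) (by norm_num)]
    simp
  rw [this, one_mul]

/-- Bernstein's inequality for convolution with a dilated kernel. -/
theorem exists_eLpNorm_kernelConv_dilate_le (m : 𝓢(RN N, ℂ)) {a : ℝ} (ha : 1 ≤ a) {b : ℝ≥0∞}
    (hab : ENNReal.ofReal a ≤ b) :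
    ∃ C : ℝ≥0, ∀ (j : ℤ) (h : RN N → ℂ), MemLp h (ENNReal.ofReal a) volume →
      eLpNorm (kernelConv (𝓕 (dilate j m)) h) b volume ≤
        C * (2 : ℝ≥0∞) ^ ((j : ℝ) * (N * (a⁻¹ - b.toReal⁻¹))) *
          eLpNorm h (ENNReal.ofReal a) volume := by
  have ha0 : 0 < a := by linarith
  have hb1 : b.toReal⁻¹ ≤ a⁻¹ := by
    rcases eq_or_ne b ∞ with rfl | hb
    · simpa using ha0.le
    · exact inv_anti₀ ha0 ((ENNReal.ofReal_le_iff_le_toReal hb).1 hab)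
  have hb0 : 0 ≤ b.toReal⁻¹ := by positivity
  have ha1 : a⁻¹ ≤ 1 := inv_le_one_of_one_le₀ ha
  obtain ⟨K, hK⟩ := exists_kernel_bound (𝓕 m)
  set K₁ := ∫⁻ x, ‖(𝓕 m) x‖ₑ
  have hK₁ : K₁ ≠ ∞ := (lintegral_kernel_lt_top (𝓕 m)).ne
  set d := a⁻¹ - b.toReal⁻¹
  have hd0 : 0 ≤ d := by simp only [d]; linarith
  have hd1 : 0 ≤ 1 - d := by simp only [d]; linarith
  have hCt : K₁ ^ (1 - d) * (K : ℝ≥0∞) ^ d ≠ ∞ := ENNReal.mul_ne_top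
    (ENNReal.rpow_ne_top_of_nonneg hd1 hK₁) (ENNReal.rpow_ne_top_of_nonneg hd0 ENNReal.coe_ne_top)
  refine ⟨(K₁ ^ (1 - d) * (K : ℝ≥0∞) ^ d).toNNReal, fun j h hh => ?_⟩
  rw [ENNReal.coe_toNNReal hCt]
  have h2 : (2 : ℝ≥0∞) ^ ((j : ℝ) * N) ≠ ∞ := by simp
  have := eLpNorm_kernelConv_le (𝓕 (dilate j m))
    (K := ((2 : ℝ≥0∞) ^ ((j : ℝ) * N)).toNNReal * K) (fun x => ?_) ha hh hab
  · refine this.trans (le_of_eq ?_)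
    rw [lintegral_fourier_dilate, ENNReal.coe_mul, ENNReal.coe_toNNReal h2,
      ENNReal.mul_rpow_of_nonneg _ _ hd0, ← ENNReal.rpow_mul, mul_assoc (j : ℝ)]
    ring
  · rw [enorm_fourier_dilate, ENNReal.coe_mul, ENNReal.coe_toNNReal h2]
    gcongr
    exact hK _

end Dilation

/-! ### Fourier multipliers as convolutions -/

section Multiplier

variable {N : ℕ}

/-- The transpose of the Fourier multiplier with symbol `m`, acting on Schwartz functions. -/
def testMultiplier (m ψ : 𝓢(RN N, ℂ)) : 𝓢(RN N, ℂ) :=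
  𝓕 (SchwartzMap.smulLeftCLM ℂ m (𝓕⁻ ψ))

theorem fourierInv_testMultiplier (m ψ : 𝓢(RN N, ℂ)) (ξ : RN N) :
    (𝓕⁻ (testMultiplier m ψ)) ξ = m ξ * (𝓕⁻ ψ) ξ := by
  simp [testMultiplier, SchwartzMap.smulLeftCLM_apply_apply m.hasTemperateGrowth]

/-- The convolution theorem for `𝓕`, transferred to `𝓕⁻` by the reflection of the frequency
variable. -/
theorem testMultiplier_apply (m ψ : 𝓢(RN N, ℂ)) (x : RN N) :
    testMultiplier m ψ x = ∫ y, (𝓕 m) (x - y) * ψ y := by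
  have h1 : 𝓕⁻ (SchwartzMap.convolution (ContinuousLinearMap.mul ℂ ℂ) (𝓕 m) ψ) =
      SchwartzMap.smulLeftCLM ℂ m (𝓕⁻ ψ) := by
    ext ξ
    rw [SchwartzMap.fourierInv_apply_eq, SchwartzMap.compCLMOfContinuousLinearEquiv_apply,
      Function.comp_apply, SchwartzMap.fourier_convolution, SchwartzMap.pairing_apply_apply,
      SchwartzMap.smulLeftCLM_apply_apply m.hasTemperateGrowth]
    have e : ∀ θ : 𝓢(RN N, ℂ), (𝓕 θ) (LinearIsometryEquiv.neg ℝ (E := RN N) ξ) = (𝓕⁻ θ) ξ := by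
      intro θ
      rw [SchwartzMap.fourierInv_apply_eq, SchwartzMap.compCLMOfContinuousLinearEquiv_apply]
      rfl
    have e1 := e (𝓕 m)
    have e2 := e ψ
    rw [FourierTransform.fourierInv_fourier_eq] at e1
    simp only [ContinuousLinearMap.mul_apply', smul_eq_mul]
    rw [← e1, ← e2]
    rfl
  have h2 : testMultiplier m ψ =
      SchwartzMap.convolution (ContinuousLinearMap.mul ℂ ℂ) (𝓕 m) ψ := by
    rw [testMultiplier, ← h1, FourierTransform.fourier_fourierInv_eq]
  rw [h2, SchwartzMap.convolution_apply, convolution_eq_swap]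
  rfl

theorem fourierMultiplier_apply (m ψ : 𝓢(RN N, ℂ)) (u : 𝓢'(RN N, ℂ)) :
    TemperedDistribution.fourierMultiplierCLM ℂ m u ψ = u (testMultiplier m ψ) := rfl

theorem dyadicBlock_eq (φ : 𝓢(RN N, ℂ)) (j : ℤ) :
    dyadicBlock φ j = TemperedDistribution.fourierMultiplierCLM ℂ (dilate j φ) := rfl

section Fubini

variable {κ : 𝓢(RN N, ℂ)} {u h : RN N → ℂ} {M : ℝ≥0∞}

/-- Thanks to the bound uniform in y, only integrability of u is needed. This allows u to be a test
function times a block about which nothing else is known. -/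
theorem integrable_mul_kernel (hu : Integrable u) (hh : AEStronglyMeasurable h volume)
    (hM : M ≠ ∞) (hb : ∀ y, ∫⁻ x, ‖κ (x - y)‖ₑ * ‖h x‖ₑ ≤ M) :
    Integrable (fun z : RN N × RN N => u z.1 * (κ (z.2 - z.1) * h z.2))
      (volume.prod volume) := by
  have hm : AEStronglyMeasurable (fun z : RN N × RN N => u z.1 * (κ (z.2 - z.1) * h z.2))
      (volume.prod volume) :=
    (hu.1.comp_fst (ν := volume)).mul (aestronglyMeasurable_kernel κ hh)
  refine ⟨hm, ?_⟩
  rw [hasFiniteIntegral_iff_enorm, lintegral_prod _ hm.enorm]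
  calc ∫⁻ y, ∫⁻ x, ‖u y * (κ (x - y) * h x)‖ₑ
      = ∫⁻ y, ‖u y‖ₑ * ∫⁻ x, ‖κ (x - y)‖ₑ * ‖h x‖ₑ := by
        refine lintegral_congr fun y => ?_
        simp_rw [enorm_mul]
        rw [lintegral_const_mul' _ _ enorm_ne_top]
    _ ≤ ∫⁻ y, ‖u y‖ₑ * M := by
        gcongr with y
        exact hb y
    _ = (∫⁻ y, ‖u y‖ₑ) * M := lintegral_mul_const' _ _ hM
    _ < ∞ := ENNReal.mul_lt_top hu.2 hM.lt_top

theorem integrable_mul_kernelConv (hu : Integrable u) (hh : AEStronglyMeasurable h volume)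
    (hM : M ≠ ∞) (hb : ∀ y, ∫⁻ x, ‖κ (x - y)‖ₑ * ‖h x‖ₑ ≤ M) :
    Integrable (fun y => u y * kernelConv κ h y) := by
  have := (integrable_mul_kernel hu hh hM hb).integral_prod_left
  simp only [integral_const_mul] at this
  exact this

theorem integral_mul_kernelConv (hu : Integrable u) (hh : AEStronglyMeasurable h volume)
    (hM : M ≠ ∞) (hb : ∀ y, ∫⁻ x, ‖κ (x - y)‖ₑ * ‖h x‖ₑ ≤ M) :
    ∫ y, u y * kernelConv κ h y = ∫ x, (∫ y, κ (x - y) * u y) * h x := by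
  have := integral_integral_swap (f := fun y x => u y * (κ (x - y) * h x))
    (integrable_mul_kernel hu hh hM hb)
  simp only [integral_const_mul] at this
  refine this.trans (integral_congr_ae (Filter.Eventually.of_forall fun x => ?_))
  simp only [← integral_mul_const]
  refine integral_congr_ae (Filter.Eventually.of_forall fun y => ?_)
  simp only
  ring

end Fubini

theorem exists_lintegral_kernel_le (κ : 𝓢(RN N, ℂ)) {h : RN N → ℂ} {a : ℝ} (ha : 1 ≤ a)
    (hh : MemLp h (ENNReal.ofReal a) volume) :
    ∃ M : ℝ≥0∞, M ≠ ∞ ∧ ∀ y, ∫⁻ x, ‖κ (x - y)‖ₑ * ‖h x‖ₑ ≤ M := by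
  obtain ⟨K, hK⟩ := exists_kernel_bound κ
  refine ⟨_, ?_, lintegral_kernel_le κ hK hh.1 ha⟩
  have hH : ∫⁻ x, ‖h x‖ₑ ^ a ≠ ∞ := by
    have := hh.2
    rw [← lintegral_enorm_rpow_eq ha] at this
    intro h'
    rw [h', ENNReal.top_rpow_of_pos (by positivity)] at this
    exact lt_irrefl _ this
  refine ENNReal.rpow_ne_top_of_nonneg (by positivity) ?_
  exact ENNReal.mul_ne_top
    (ENNReal.rpow_ne_top_of_nonneg (by linarith) (lintegral_kernel_lt_top κ).ne)
    (ENNReal.mul_ne_top ENNReal.coe_ne_top hH)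

/-- An `L^p` function gives a tempered distribution. -/
theorem isGivenBy_toTemperedDistribution {p : ℝ≥0∞} [hp : Fact (1 ≤ p)] {h : RN N → ℂ}
    (hh : MemLp h p volume) :
    IsGivenBy (Lp.toTemperedDistribution (hh.toLp h) : 𝓢'(RN N, ℂ)) h where
  locallyIntegrable := hh.locallyIntegrable hp.out
  integrable ψ := by
    have := ENNReal.HolderConjugate.inv_one_sub_inv' hp.out
    exact memLp_one_iff_integrable.1 (hh.mul' (ψ.memLp (1 - p⁻¹)⁻¹))
  apply_eq ψ := by
    rw [Lp.toTemperedDistribution_apply]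
    refine integral_congr_ae ?_
    filter_upwards [hh.coeFn_toLp] with x hx
    rw [hx, smul_eq_mul]

/-- A Fourier multiplier with Schwartz symbol acts on `L^a` functions by convolution. -/
theorem IsGivenBy.fourierMultiplier {u : 𝓢'(RN N, ℂ)} {h : RN N → ℂ} (H : IsGivenBy u h)
    (m : 𝓢(RN N, ℂ)) {a : ℝ} (ha : 1 ≤ a) (hh : MemLp h (ENNReal.ofReal a) volume) :
    IsGivenBy (TemperedDistribution.fourierMultiplierCLM ℂ m u) (kernelConv (𝓕 m) h) := by
  obtain ⟨M, hM, hb⟩ := exists_lintegral_kernel_le (𝓕 m) ha hh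
  refine ⟨?_, fun ψ => integrable_mul_kernelConv ψ.integrable hh.1 hM hb, fun ψ => ?_⟩
  · have : MemLp (kernelConv (𝓕 m) h) ∞ volume := by
      refine ⟨aestronglyMeasurable_kernelConv _ hh.1, lt_of_le_of_lt ?_ hM.lt_top⟩
      rw [eLpNorm_exponent_top]
      exact eLpNormEssSup_le_of_ae_enorm_bound
        (Filter.Eventually.of_forall fun y => (enorm_kernelConv_le _ h y).trans (hb y))
    exact this.locallyIntegrable le_top
  · rw [fourierMultiplier_apply, H.apply_eq, integral_mul_kernelConv ψ.integrable hh.1 hM hb]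
    refine integral_congr_ae (Filter.Eventually.of_forall fun x => ?_)
    simp only [testMultiplier_apply]

theorem IsGivenBy.lpNorm_eq {u : 𝓢'(RN N, ℂ)} {h : RN N → ℂ} (H : IsGivenBy u h) (p : ℝ≥0∞) :
    lpNorm p u = eLpNorm h p volume :=
  le_antisymm (iInf₂_le h H) (le_iInf₂ fun _ H' => (eLpNorm_congr_ae (H.ae_eq H')).le)

theorem exists_isGivenBy_memLp {u : 𝓢'(RN N, ℂ)} {p : ℝ≥0∞} (hu : lpNorm p u < ∞) :
    ∃ h, IsGivenBy u h ∧ MemLp h p volume := by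
  simp only [lpNorm, iInf_lt_iff] at hu
  obtain ⟨h, H, hlt⟩ := hu
  exact ⟨h, H, H.locallyIntegrable.aestronglyMeasurable, hlt⟩

end Multiplier

/-! ### Reproducing a frequency block by a ball cutoff -/

section Cutoff

/-- A smooth cutoff that equals `1` for `|ξ| ≤ 3` and vanishes for `|ξ| ≥ 4`. -/
structure IsBallCutoff {N : ℕ} (χ : 𝓢(RN N, ℂ)) : Prop where
  eq_one : ∀ ξ : RN N, ‖ξ‖ ≤ 3 → χ ξ = 1
  eq_zero : ∀ ξ : RN N, 4 ≤ ‖ξ‖ → χ ξ = 0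
  norm_one_sub_le : ∀ ξ : RN N, ‖1 - χ ξ‖ ≤ 1

theorem exists_isBallCutoff (N : ℕ) : ∃ χ : 𝓢(RN N, ℂ), IsBallCutoff χ := by
  let b : ContDiffBump (0 : RN N) := ⟨3, 4, by norm_num, by norm_num⟩
  have hc : HasCompactSupport (Complex.ofRealCLM ∘ b) := b.hasCompactSupport.comp_left rfl
  refine ⟨hc.toSchwartzMap (by have := b.contDiff (n := ⊤); fun_prop), ?_, ?_, ?_⟩
  · intro ξ hξ
    have : b ξ = 1 := b.one_of_mem_closedBall (by simpa [b] using hξ)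
    simp [this]
  · intro ξ hξ
    have : b ξ = 0 := b.zero_of_le_dist (by simpa [b] using hξ)
    simp [this]
  · intro ξ
    have h0 := b.nonneg (x := ξ)
    have h1 := b.le_one (x := ξ)
    have : (1 - (b ξ : ℂ)) = ((1 - b ξ : ℝ) : ℂ) := by push_cast; ring
    simp only [HasCompactSupport.toSchwartzMap_toFun, Function.comp_apply,
      Complex.ofRealCLM_apply, this, Complex.norm_real, Real.norm_eq_abs]
    rw [abs_of_nonneg (by linarith)]
    linarith

variable {N : ℕ} {φ χ : 𝓢(RN N, ℂ)}

theorem norm_zpow_smul (j : ℤ) (ξ : RN N) : ‖(2 : ℝ) ^ (-j) • ξ‖ = ‖ξ‖ / 2 ^ j := by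
  rw [norm_smul, norm_zpow, zpow_neg, Real.norm_ofNat, div_eq_inv_mul]

theorem IsBallCutoff.dilate_eq_one (hχ : IsBallCutoff χ) {j : ℤ} {ξ : RN N}
    (h : ‖ξ‖ ≤ 3 * 2 ^ j) : dilate j χ ξ = 1 := by
  rw [dilate_apply]
  refine hχ.eq_one _ ?_
  rw [norm_zpow_smul]
  exact (div_le_iff₀ (by positivity)).2 h

theorem IsBallCutoff.dilate_eq_zero (hχ : IsBallCutoff χ) {j : ℤ} {ξ : RN N}
    (h : 4 * 2 ^ j ≤ ‖ξ‖) : dilate j χ ξ = 0 := by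
  rw [dilate_apply]
  refine hχ.eq_zero _ ?_
  rw [norm_zpow_smul]
  exact (le_div_iff₀ (by positivity)).2 h

theorem IsDyadicGenerator.of_dilate_ne_zero (hφ : IsDyadicGenerator φ) {j : ℤ} {ξ : RN N}
    (h : dilate j φ ξ ≠ 0) : 3 / 4 * 2 ^ j ≤ ‖ξ‖ ∧ ‖ξ‖ ≤ 8 / 3 * 2 ^ j := by
  have := hφ.support (show (2 : ℝ) ^ (-j) • ξ ∈ Function.support φ from h)
  simp only [Set.mem_ofPred_eq, norm_zpow_smul] at this
  exact ⟨(le_div_iff₀ (by positivity)).1 this.1, (div_le_iff₀ (by positivity)).1 this.2⟩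

/-- A frequency block is reproduced by the kernel of a ball cutoff. -/
theorem IsGivenBy.ae_eq_kernelConv (hφ : IsDyadicGenerator φ) (hχ : IsBallCutoff χ)
    {f : 𝓢'(RN N, ℂ)} {k : ℤ} {F : RN N → ℂ} (H : IsGivenBy (dyadicBlock φ k f) F) {a : ℝ}
    (ha : 1 ≤ a) (hF : MemLp F (ENNReal.ofReal a) volume) :
    F =ᵐ[volume] kernelConv (𝓕 (dilate k χ)) F := by
  have hrep := H.fourierMultiplier (dilate k χ) ha hF
  rw [dyadicBlock_eq, TemperedDistribution.fourierMultiplierCLM_fourierMultiplierCLM_apply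
    (dilate k φ).hasTemperateGrowth (dilate k χ).hasTemperateGrowth] at hrep
  -- The block symbol lives in |ξ| ≤ 8/3 · 2^k, inside the ball of radius 3 · 2^k where the cutoff
  -- is 1.
  have e : (⇑(dilate k φ) * ⇑(dilate k χ)) = dilate k φ := by
    funext ξ
    rw [Pi.mul_apply]
    by_cases h : dilate k φ ξ = 0
    · rw [h, zero_mul]
    · rw [hχ.dilate_eq_one, mul_one]
      refine (hφ.of_dilate_ne_zero h).2.trans ?_
      gcongr
      norm_num
  rw [e] at hrep
  exact H.ae_eq hrep

/-- Bernstein's inequality for frequency blocks. -/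
theorem exists_bernstein (hφ : IsDyadicGenerator φ) {a : ℝ} (ha : 1 ≤ a) {b : ℝ≥0∞}
    (hab : ENNReal.ofReal a ≤ b) :
    ∃ C : ℝ≥0, ∀ (f : 𝓢'(RN N, ℂ)) (k : ℤ) (F : RN N → ℂ), IsGivenBy (dyadicBlock φ k f) F →
      MemLp F (ENNReal.ofReal a) volume →
      eLpNorm F b volume ≤ C * (2 : ℝ≥0∞) ^ ((k : ℝ) * (N * (a⁻¹ - b.toReal⁻¹))) *
          eLpNorm F (ENNReal.ofReal a) volume := by
  obtain ⟨χ, hχ⟩ := exists_isBallCutoff N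
  obtain ⟨C, hC⟩ := exists_eLpNorm_kernelConv_dilate_le χ ha hab
  refine ⟨C, fun f k F H hF => ?_⟩
  rw [eLpNorm_congr_ae (H.ae_eq_kernelConv hφ hχ ha hF)]
  exact (hC k F hF)

end Cutoff

/-! ### Spectral localization of products of blocks -/

section Spectrum

variable {N : ℕ} {φ χ : 𝓢(RN N, ℂ)}

theorem fourier_compSubConst_apply (θ : 𝓢(RN N, ℂ)) (η y : RN N) :
    (𝓕 (SchwartzMap.compSubConstCLM ℂ (-η) θ)) y =
      Real.fourierChar (inner ℝ y η) • (𝓕 θ) y := by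
  have e : ⇑(SchwartzMap.compSubConstCLM ℂ (-η) θ) = θ ∘ fun v => v + η := by
    funext v
    simp
  rw [SchwartzMap.fourier_coe, SchwartzMap.fourier_coe, e]
  have := congrFun (VectorFourier.fourierIntegral_comp_add_right Real.fourierChar volume
    (innerₗ (RN N)) θ η) y
  refine this.trans ?_
  rw [innerₗ_apply_apply, real_inner_comm]
  rfl

/-- Multiplication by a translated kernel `𝓕 m` enlarges the spectrum by the support of `m`. -/
theorem fourierInv_kernel_mul_eq_zero (m ψ : 𝓢(RN N, ℂ)) (x η : RN N)
    (h : ∀ ζ, m ζ ≠ 0 → (𝓕⁻ ψ) (η + ζ) = 0) :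
    (𝓕⁻ (SchwartzMap.smulLeftCLM ℂ (fun y => (𝓕 m) (x - y)) ψ)) η = 0 := by
  have hg : Function.HasTemperateGrowth (fun y => (𝓕 m) (x - y)) :=
    (𝓕 m).hasTemperateGrowth.comp (by fun_prop)
  -- `e` is ψ modulated by the character of frequency η, so that `𝓕⁻ e` is a translate of `𝓕⁻ ψ`.
  -- The quantity to compute is `testMultiplier m e` at x, and its symbol vanishes by hypothesis.
  set e := 𝓕 (SchwartzMap.compSubConstCLM ℂ (-η) (𝓕⁻ ψ)) with he
  have h0 : testMultiplier m e = 0 := by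
    have : SchwartzMap.smulLeftCLM ℂ m (𝓕⁻ e) = 0 := by
      ext ζ
      rw [SchwartzMap.smulLeftCLM_apply_apply m.hasTemperateGrowth, he,
        FourierTransform.fourierInv_fourier_eq, SchwartzMap.compSubConstCLM_apply,
        sub_neg_eq_add, smul_eq_mul]
      by_cases hζ : m ζ = 0
      · rw [hζ, zero_mul]
        rfl
      · rw [add_comm, h ζ hζ, mul_zero]
        rfl
    rw [testMultiplier, this]
    exact map_zero (FourierTransform.fourierCLM ℂ 𝓢(RN N, ℂ))
  have h1 := testMultiplier_apply m e x
  rw [h0] at h1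
  rw [SchwartzMap.fourierInv_coe, Real.fourierInv_eq]
  refine Eq.trans (integral_congr_ae (Filter.Eventually.of_forall fun y => ?_)) h1.symm
  simp only [he, fourier_compSubConst_apply, SchwartzMap.smulLeftCLM_apply_apply hg,
    FourierTransform.fourier_fourierInv_eq, smul_eq_mul, Circle.smul_def]
  ring

/-- The spectrum of a product of two frequency blocks lies in the sum of the spectra. -/
theorem integral_mul_blocks_eq_zero (hφ : IsDyadicGenerator φ)
    {f g : 𝓢'(RN N, ℂ)} {k l : ℤ} {F G : RN N → ℂ} (HF : IsGivenBy (dyadicBlock φ k f) F)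
    {a : ℝ} (ha : 1 ≤ a) (hF : MemLp F (ENNReal.ofReal a) volume)
    (HG : IsGivenBy (dyadicBlock φ l g) G) {ψ : 𝓢(RN N, ℂ)}
    (hψ : ∀ ξ : RN N, 3 / 4 * 2 ^ l - 4 * 2 ^ k ≤ ‖ξ‖ → ‖ξ‖ ≤ 8 / 3 * 2 ^ l + 4 * 2 ^ k →
      (𝓕⁻ ψ) ξ = 0) :
    ∫ x, ψ x * (F x * G x) = 0 := by
  obtain ⟨χ, hχ⟩ := exists_isBallCutoff N
  set κ := 𝓕 (dilate k χ) with hκ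
  obtain ⟨M, hM, hb⟩ := exists_lintegral_kernel_le κ ha hF
  -- F is replaced by its own convolution and the kernel is moved onto ψ by Fubini. It then suffices
  -- to test G against κ(x - ·) ψ for each fixed x, so no Fourier transform of the product is
  -- required.
  have h1 : ∫ x, ψ x * (F x * G x) = ∫ y, (ψ y * G y) * kernelConv κ F y := by
    refine integral_congr_ae ?_
    filter_upwards [HF.ae_eq_kernelConv hφ hχ ha hF] with x hx
    rw [← hx]
    ring
  rw [h1, integral_mul_kernelConv (HG.integrable ψ) hF.1 hM hb]
  have h2 : ∀ x, ∫ y, κ (x - y) * (ψ y * G y) = 0 := by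
    intro x
    have hg : Function.HasTemperateGrowth (fun y => κ (x - y)) :=
      κ.hasTemperateGrowth.comp (by fun_prop)
    have h3 := HG.apply_eq (SchwartzMap.smulLeftCLM ℂ (fun y => κ (x - y)) ψ)
    rw [dyadicBlock_eq, fourierMultiplier_apply] at h3
    have h4 : testMultiplier (dilate l φ) (SchwartzMap.smulLeftCLM ℂ (fun y => κ (x - y)) ψ) =
        0 := by
      have : SchwartzMap.smulLeftCLM ℂ (dilate l φ)
          (𝓕⁻ (SchwartzMap.smulLeftCLM ℂ (fun y => κ (x - y)) ψ)) = 0 := by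
        ext η
        rw [SchwartzMap.smulLeftCLM_apply_apply (dilate l φ).hasTemperateGrowth, smul_eq_mul]
        by_cases hη : dilate l φ η = 0
        · rw [hη, zero_mul]
          rfl
        · rw [fourierInv_kernel_mul_eq_zero, mul_zero]
          · rfl
          intro ζ hζ
          have hζ' : ‖ζ‖ ≤ 4 * 2 ^ k := by
            by_contra hcon
            exact hζ (hχ.dilate_eq_zero (not_le.1 hcon).le)
          obtain ⟨hη1, hη2⟩ := hφ.of_dilate_ne_zero hη
          refine hψ _ ?_ ?_
          · have := norm_sub_le (η + ζ) ζ
            rw [add_sub_cancel_right] at this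
            linarith
          · exact (norm_add_le _ _).trans (add_le_add hη2 hζ')
      rw [testMultiplier, this]
      exact map_zero (FourierTransform.fourierCLM ℂ 𝓢(RN N, ℂ))
    rw [h4, map_zero] at h3
    rw [h3]
    refine integral_congr_ae (Filter.Eventually.of_forall fun y => ?_)
    simp only [SchwartzMap.smulLeftCLM_apply_apply hg, smul_eq_mul]
    ring
  simp [h2]

theorem zpow_bound_of_le {k l : ℤ} (n : ℤ) (h : k ≤ l + n) : (2 : ℝ) ^ k ≤ 2 ^ n * 2 ^ l := by
  rw [← zpow_add₀ (by norm_num), add_comm]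
  exact zpow_le_zpow_right₀ (by norm_num) h

variable {f g : 𝓢'(RN N, ℂ)} {k l : ℤ} {F G : RN N → ℂ} {a : ℝ} {ψ : 𝓢(RN N, ℂ)}

/-- The radius comes from 8/3 + 4 · 2^3 ≤ 36. Comparable frequencies can interact down to frequency
zero, hence a ball and not an annulus. -/
theorem integral_mul_blocks_eq_zero_of_le (hφ : IsDyadicGenerator φ)
    (HF : IsGivenBy (dyadicBlock φ k f) F) (ha : 1 ≤ a)
    (hF : MemLp F (ENNReal.ofReal a) volume) (HG : IsGivenBy (dyadicBlock φ l g) G)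
    (hkl : k ≤ l + 3) (hψ : ∀ ξ : RN N, ‖ξ‖ ≤ 36 * 2 ^ l → (𝓕⁻ ψ) ξ = 0) :
    ∫ x, ψ x * (F x * G x) = 0 := by
  refine integral_mul_blocks_eq_zero hφ HF ha hF HG fun ξ _ h2 => hψ ξ (h2.trans ?_)
  have := zpow_bound_of_le 3 hkl
  have hl : (0 : ℝ) < 2 ^ l := by positivity
  norm_num at this
  linarith

/-- A gap of 4 makes the smaller spectrum, of radius 4 · 2^k ≤ 2^l / 4, too small to fill the
annulus: 3/4 - 1/4 = 1/2 and 8/3 + 1/4 ≤ 3. -/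
theorem integral_mul_blocks_eq_zero_of_lt (hφ : IsDyadicGenerator φ)
    (HF : IsGivenBy (dyadicBlock φ k f) F) (ha : 1 ≤ a)
    (hF : MemLp F (ENNReal.ofReal a) volume) (HG : IsGivenBy (dyadicBlock φ l g) G)
    (hkl : k ≤ l - 4)
    (hψ : ∀ ξ : RN N, 1 / 2 * 2 ^ l ≤ ‖ξ‖ → ‖ξ‖ ≤ 3 * 2 ^ l → (𝓕⁻ ψ) ξ = 0) :
    ∫ x, ψ x * (F x * G x) = 0 := by
  have := zpow_bound_of_le (-4) hkl
  have hl : (0 : ℝ) < 2 ^ l := by positivity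
  norm_num at this
  refine integral_mul_blocks_eq_zero hφ HF ha hF HG fun ξ h1 h2 =>
    hψ ξ (le_trans ?_ h1) (h2.trans ?_)
  · linarith
  · linarith

/-- The blocks of a product of blocks that vanish: comparable frequencies. -/
theorem block_eq_zero_of_le (hφ : IsDyadicGenerator φ)
    (HF : IsGivenBy (dyadicBlock φ k f) F) (ha : 1 ≤ a)
    (hF : MemLp F (ENNReal.ofReal a) volume) (HG : IsGivenBy (dyadicBlock φ l g) G)
    {u : 𝓢'(RN N, ℂ)} (hu : IsGivenBy u fun x => F x * G x) (hkl : k ≤ l + 3) {j : ℤ}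
    (hj : l + 5 < j) : dyadicBlock φ j u = 0 := by
  ext ψ
  rw [dyadicBlock_eq, fourierMultiplier_apply, hu.apply_eq]
  refine integral_mul_blocks_eq_zero_of_le hφ HF ha hF HG hkl fun ξ hξ => ?_
  rw [fourierInv_testMultiplier]
  by_contra hne
  have h1 := (hφ.of_dilate_ne_zero (left_ne_zero_of_mul hne)).1
  -- From j ≥ l + 6 the block starts at 3/4 · 64 · 2^l = 48 · 2^l, beyond 36 · 2^l.
  have := zpow_bound_of_le (k := l) (l := j) (-6) (by omega)
  have hl : (0 : ℝ) < 2 ^ j := by positivity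
  norm_num at this
  linarith

/-- The blocks of a product of blocks that vanish: separated frequencies. -/
theorem block_eq_zero_of_lt (hφ : IsDyadicGenerator φ)
    (HF : IsGivenBy (dyadicBlock φ k f) F) (ha : 1 ≤ a)
    (hF : MemLp F (ENNReal.ofReal a) volume) (HG : IsGivenBy (dyadicBlock φ l g) G)
    {u : 𝓢'(RN N, ℂ)} (hu : IsGivenBy u fun x => F x * G x) (hkl : k ≤ l - 4) {j : ℤ}
    (hj : 2 < |j - l|) : dyadicBlock φ j u = 0 := by
  ext ψ
  rw [dyadicBlock_eq, fourierMultiplier_apply, hu.apply_eq]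
  refine integral_mul_blocks_eq_zero_of_lt hφ HF ha hF HG hkl fun ξ hξ hξ' => ?_
  rw [fourierInv_testMultiplier]
  by_contra hne
  obtain ⟨h1, h2⟩ := hφ.of_dilate_ne_zero (left_ne_zero_of_mul hne)
  have hl : (0 : ℝ) < 2 ^ l := by positivity
  -- With a distance of at least 3, the block lies above 3/4 · 8 = 6 > 3 or below 8/3 · 1/8 = 1/3 <
  -- 1/2, in units of 2^l.
  rcases lt_abs.1 hj with h | h
  · have := zpow_bound_of_le (k := l) (l := j) (-3) (by omega)
    norm_num at this
    linarith
  · have := zpow_bound_of_le (k := j) (l := l) (-3) (by omega)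
    norm_num at this
    linarith

end Spectrum

/-! ### Decay of the pairing with a test function -/

section Pairing

variable {N : ℕ} {φ : 𝓢(RN N, ℂ)}

/-- Hölder's inequality for the pairing of a test function with a function. -/
theorem enorm_integral_mul_le {h₁ h₂ : RN N → ℂ} (m₁ : AEStronglyMeasurable h₁ volume)
    (m₂ : AEStronglyMeasurable h₂ volume) (p q : ℝ≥0∞) [ENNReal.HolderTriple p q 1] :
    ‖∫ x, h₁ x * h₂ x‖ₑ ≤ eLpNorm h₁ p volume * eLpNorm h₂ q volume := by
  refine (enorm_integral_le_lintegral_enorm _).trans ?_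
  rw [← eLpNorm_one_eq_lintegral_enorm]
  exact eLpNorm_smul_le_mul_eLpNorm (p := p) (q := q) (r := 1) (f := h₂) (φ := h₁) m₂ m₁

/-- A continuous functional `Q` on Schwartz functions that controls pairings. -/
structure IsTestBound (Q : 𝓢(RN N, ℂ) → ℝ≥0∞) : Prop where
  continuous : Continuous Q
  map_zero : Q 0 = 0
  ne_top : ∀ ψ, Q ψ ≠ ∞

theorem IsTestBound.add {Q₁ Q₂ : 𝓢(RN N, ℂ) → ℝ≥0∞} (h₁ : IsTestBound Q₁) (h₂ : IsTestBound Q₂) :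
    IsTestBound fun ψ => Q₁ ψ + Q₂ ψ :=
  ⟨h₁.continuous.add h₂.continuous, by simp [h₁.map_zero, h₂.map_zero],
    fun ψ => ENNReal.add_ne_top.2 ⟨h₁.ne_top ψ, h₂.ne_top ψ⟩⟩

theorem isTestBound_eLpNorm (L : 𝓢(RN N, ℂ) →L[ℂ] 𝓢(RN N, ℂ)) (C : ℝ≥0) (p : ℝ≥0∞)
    [Fact (1 ≤ p)] : IsTestBound fun ψ => C * eLpNorm (L ψ) p volume := by
  have e : ∀ ψ : 𝓢(RN N, ℂ), eLpNorm (L ψ) p volume =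
      ‖SchwartzMap.toLpCLM ℂ ℂ p volume (L ψ)‖ₑ := by
    intro ψ
    rw [SchwartzMap.toLpCLM_apply, Lp.enorm_def]
    exact (eLpNorm_congr_ae (SchwartzMap.coeFn_toLp _ _ _)).symm
  simp_rw [e]
  refine ⟨?_, by rw [map_zero, map_zero, enorm_zero, mul_zero], fun ψ => ENNReal.mul_ne_top ENNReal.coe_ne_top enorm_ne_top⟩
  refine (ENNReal.continuous_const_mul ENNReal.coe_ne_top).comp ?_
  exact ((SchwartzMap.toLpCLM ℂ ℂ p volume).continuous.comp L.continuous).enorm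

/-- Products of blocks at low frequency paired with a test function. -/
theorem exists_pairing_low (hφ : IsDyadicGenerator φ) {a : ℝ} (ha : 1 ≤ a) :
    ∃ Q : 𝓢(RN N, ℂ) → ℝ≥0∞, IsTestBound Q ∧
      ∀ (f g : 𝓢'(RN N, ℂ)) (k l : ℤ) (F G : RN N → ℂ), IsGivenBy (dyadicBlock φ k f) F →
        MemLp F (ENNReal.ofReal a) volume → IsGivenBy (dyadicBlock φ l g) G →
        MemLp (fun x => F x * G x) 2 volume → k ≤ l + 3 → ∀ ψ : 𝓢(RN N, ℂ),
        ‖∫ x, ψ x * (F x * G x)‖ₑ ≤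
          eLpNorm (fun x => F x * G x) 2 volume * (2 : ℝ≥0∞) ^ ((l : ℝ) * (N / 2)) * Q ψ := by
  obtain ⟨χ, hχ⟩ := exists_isBallCutoff N
  obtain ⟨C, hC⟩ := exists_eLpNorm_kernelConv_dilate_le χ (a := 2) (b := ∞) (by norm_num) le_top
  let D : ℝ≥0∞ := C * (2 : ℝ≥0∞) ^ ((4 : ℝ) * (N / 2))
  have hD : D ≠ ∞ := ENNReal.mul_ne_top ENNReal.coe_ne_top (by simp)
  refine ⟨_, isTestBound_eLpNorm (ContinuousLinearMap.id ℂ _) D.toNNReal 1, ?_⟩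
  intro f g k l F G HF hF HG hP hkl ψ
  have hu := isGivenBy_toTemperedDistribution hP
  set u : 𝓢'(RN N, ℂ) := Lp.toTemperedDistribution (hP.toLp fun x => F x * G x) with hu_def
  have hP' : MemLp (fun x => F x * G x) (ENNReal.ofReal 2) volume := by simpa using hP
  -- The shift by 4 makes the cutoff equal to 1 up to 3 · 16 · 2^l = 48 · 2^l, past the radius 36 ·
  -- 2^l of the spectrum. The product is thus reproduced, and Bernstein takes it from L^2 to L^∞.
  have e : TemperedDistribution.fourierMultiplierCLM ℂ (dilate (l + 4) χ) u = u := by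
    ext η
    rw [fourierMultiplier_apply, ← sub_eq_zero, ← map_sub, hu.apply_eq]
    refine integral_mul_blocks_eq_zero_of_le hφ HF ha hF HG hkl fun ξ hξ => ?_
    have : (𝓕⁻ (testMultiplier (dilate (l + 4) χ) η - η)) ξ =
        (𝓕⁻ (testMultiplier (dilate (l + 4) χ) η)) ξ - (𝓕⁻ η) ξ := by
      rw [show 𝓕⁻ (testMultiplier (dilate (l + 4) χ) η - η) =
        𝓕⁻ (testMultiplier (dilate (l + 4) χ) η) - 𝓕⁻ η from
        map_sub (FourierTransform.fourierInvCLM ℂ 𝓢(RN N, ℂ)) _ _]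
      rfl
    rw [this, fourierInv_testMultiplier, hχ.dilate_eq_one, one_mul, sub_self]
    refine hξ.trans ?_
    rw [zpow_add₀ (by norm_num)]
    have hl : (0 : ℝ) < 2 ^ l := by positivity
    norm_num
    linarith
  have hu' := hu.fourierMultiplier (dilate (l + 4) χ) (by norm_num) hP'
  rw [e] at hu'
  have h1 := enorm_integral_mul_le (p := 1) (q := ∞) ψ.continuous.aestronglyMeasurable hP.1
  refine h1.trans ?_
  have h2 := hC (l + 4) _ hP'
  rw [← eLpNorm_congr_ae (hu.ae_eq hu')] at h2
  calc _ ≤ eLpNorm ψ 1 volume * (C * (2 : ℝ≥0∞) ^ (((l + 4 : ℤ) : ℝ) *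
        (N * ((2 : ℝ)⁻¹ - (∞ : ℝ≥0∞).toReal⁻¹))) *
          eLpNorm (fun x => F x * G x) (ENNReal.ofReal 2) volume) := by gcongr
    _ = _ := by
      rw [ENNReal.coe_toNNReal hD]
      have : (2 : ℝ≥0∞) ^ (((l + 4 : ℤ) : ℝ) * (N * ((2 : ℝ)⁻¹ - (∞ : ℝ≥0∞).toReal⁻¹))) =
          (2 : ℝ≥0∞) ^ ((l : ℝ) * (N / 2)) * (2 : ℝ≥0∞) ^ ((4 : ℝ) * (N / 2)) := by
        rw [← ENNReal.rpow_add _ _ (by norm_num) (by norm_num)]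
        congr 1
        push_cast
        simp
        ring
      rw [this, ENNReal.ofReal_ofNat]
      simp only [D, ContinuousLinearMap.id_apply]
      ring

theorem eLpNorm_fourierInv_two (ψ : 𝓢(RN N, ℂ)) :
    eLpNorm (𝓕⁻ ψ : 𝓢(RN N, ℂ)) 2 volume = eLpNorm ψ 2 volume := by
  have h := SchwartzMap.norm_fourier_toL2_eq (𝓕⁻ ψ : 𝓢(RN N, ℂ))
  rw [FourierTransform.fourier_fourierInv_eq, SchwartzMap.norm_toLp, SchwartzMap.norm_toLp] at h
  exact ((ENNReal.toReal_eq_toReal_iff' (ψ.eLpNorm_lt_top 2 volume).ne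
    ((𝓕⁻ ψ : 𝓢(RN N, ℂ)).eLpNorm_lt_top 2 volume).ne).1 h).symm

/-- Products of blocks of separated frequencies paired with a test function. -/
theorem exists_pairing_high (hφ : IsDyadicGenerator φ) {a : ℝ} (ha : 1 ≤ a) (n : ℕ) :
    ∃ Q : 𝓢(RN N, ℂ) → ℝ≥0∞, IsTestBound Q ∧
      ∀ (f g : 𝓢'(RN N, ℂ)) (k l : ℤ) (F G : RN N → ℂ), IsGivenBy (dyadicBlock φ k f) F →
        MemLp F (ENNReal.ofReal a) volume → IsGivenBy (dyadicBlock φ l g) G →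
        MemLp (fun x => F x * G x) 2 volume → k ≤ l - 4 → ∀ ψ : 𝓢(RN N, ℂ),
        ‖∫ x, ψ x * (F x * G x)‖ₑ ≤
          eLpNorm (fun x => F x * G x) 2 volume * (2 : ℝ≥0∞) ^ ((l : ℝ) * (-(2 * n))) * Q ψ := by
  obtain ⟨χ, hχ⟩ := exists_isBallCutoff N
  have hg : Function.HasTemperateGrowth (fun ξ : RN N => (((‖ξ‖ ^ 2) ^ n : ℝ) : ℂ)) := by
    fun_prop
  let L : 𝓢(RN N, ℂ) →L[ℂ] 𝓢(RN N, ℂ) :=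
    (SchwartzMap.smulLeftCLM ℂ (fun ξ : RN N => (((‖ξ‖ ^ 2) ^ n : ℝ) : ℂ))).comp
      (FourierTransform.fourierInvCLM ℂ 𝓢(RN N, ℂ))
  have hL : ∀ ψ ξ, ‖L ψ ξ‖ = (‖ξ‖ ^ 2) ^ n * ‖(𝓕⁻ ψ) ξ‖ := by
    intro ψ ξ
    have : L ψ ξ = (((‖ξ‖ ^ 2) ^ n : ℝ) : ℂ) * (𝓕⁻ ψ) ξ :=
      SchwartzMap.smulLeftCLM_apply_apply hg _ _
    rw [this, norm_mul, Complex.norm_real, Real.norm_of_nonneg (by positivity)]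
  refine ⟨_, isTestBound_eLpNorm L (16 ^ n) 2, ?_⟩
  intro f g k l F G HF hF HG hP hkl ψ
  -- The removed part has frequencies below 4 · 2^{l-3} = 2^l / 2, which the product does not see.
  -- What is left has |ξ| > 3/8 · 2^l, so weighting by |ξ|^{2n} gains (2^l / 4)^{-2n}; this is where
  -- 16^n comes from.
  set ψ' := ψ - testMultiplier (dilate (l - 3) χ) ψ with hψ'
  have hψ'_f : ∀ ξ, (𝓕⁻ ψ') ξ = (1 - dilate (l - 3) χ ξ) * (𝓕⁻ ψ) ξ := by
    intro ξ
    rw [hψ', show 𝓕⁻ (ψ - testMultiplier (dilate (l - 3) χ) ψ) =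
        𝓕⁻ ψ - 𝓕⁻ (testMultiplier (dilate (l - 3) χ) ψ) from
        map_sub (FourierTransform.fourierInvCLM ℂ 𝓢(RN N, ℂ)) _ _, sub_mul, one_mul,
        ← fourierInv_testMultiplier]
    rfl
  have hu := isGivenBy_toTemperedDistribution hP
  have hl : (0 : ℝ) < 2 ^ l := by positivity
  have hl3 : (2 : ℝ) ^ (l - 3) = 1 / 8 * 2 ^ l := by
    rw [zpow_sub₀ (by norm_num)]
    norm_num
    ring
  have h0 : ∫ x, ψ x * (F x * G x) = ∫ x, ψ' x * (F x * G x) := by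
    rw [← sub_eq_zero, ← hu.apply_eq, ← hu.apply_eq, ← map_sub, hu.apply_eq]
    refine integral_mul_blocks_eq_zero_of_lt hφ HF ha hF HG hkl fun ξ hξ _ => ?_
    rw [hψ', sub_sub_cancel, fourierInv_testMultiplier, hχ.dilate_eq_zero, zero_mul]
    refine le_trans ?_ hξ
    rw [hl3]
    linarith
  rw [h0]
  refine (enorm_integral_mul_le (p := 2) (q := 2) ψ'.continuous.aestronglyMeasurable hP.1).trans ?_
  have h1 : eLpNorm ψ' 2 volume ≤
      ENNReal.ofReal (((1 / 4 * (2 : ℝ) ^ l) ^ (2 * n))⁻¹) * eLpNorm (L ψ) 2 volume := by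
    rw [← eLpNorm_fourierInv_two]
    refine eLpNorm_le_mul_eLpNorm_of_ae_le_mul (Filter.Eventually.of_forall fun ξ => ?_) 2
    rw [hψ'_f, norm_mul, hL]
    rcases le_or_gt ‖ξ‖ (3 * 2 ^ (l - 3)) with h | h
    · rw [hχ.dilate_eq_one h, sub_self, norm_zero, zero_mul]
      positivity
    · rw [← mul_assoc]
      gcongr
      refine (hχ.norm_one_sub_le _).trans ?_
      rw [← pow_mul, inv_mul_eq_div, one_le_div (by positivity)]
      gcongr
      rw [hl3] at h
      linarith
  have h2 : ENNReal.ofReal (((1 / 4 * (2 : ℝ) ^ l) ^ (2 * n))⁻¹) =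
      (2 : ℝ≥0∞) ^ ((l : ℝ) * (-(2 * n))) * 16 ^ n := by
    have : ((1 / 4 * (2 : ℝ) ^ l) ^ (2 * n))⁻¹ = (2 : ℝ) ^ ((l : ℝ) * (-(2 * n))) * 16 ^ n := by
      rw [mul_pow, mul_inv, mul_comm, mul_neg, Real.rpow_neg (by norm_num),
        Real.rpow_mul (by norm_num), Real.rpow_intCast]
      congr 1
      · rw [← Real.rpow_natCast]
        push_cast
        rfl
      · rw [pow_mul, ← inv_pow]
        norm_num
    rw [this, ENNReal.ofReal_mul (by positivity), ← ENNReal.ofReal_rpow_of_pos (by norm_num),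
      ENNReal.ofReal_pow (by norm_num)]
    norm_num
  rw [h2] at h1
  calc _ ≤ ((2 : ℝ≥0∞) ^ ((l : ℝ) * (-(2 * n))) * 16 ^ n * eLpNorm (L ψ) 2 volume) *
        eLpNorm (fun x => F x * G x) 2 volume := by gcongr
    _ = _ := by
      push_cast
      ring

end Pairing

/-! ### Sums of powers of two -/

section Sums

theorem two_rpow_add (x y : ℝ) : (2 : ℝ≥0∞) ^ (x + y) = 2 ^ x * 2 ^ y :=
  ENNReal.rpow_add _ _ (by norm_num) (by norm_num)

theorem two_rpow_mono {x y : ℝ} (h : x ≤ y) : (2 : ℝ≥0∞) ^ x ≤ 2 ^ y :=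
  ENNReal.rpow_le_rpow_of_exponent_le (by norm_num) h

theorem two_rpow_ne_top (x : ℝ) : (2 : ℝ≥0∞) ^ x ≠ ∞ := by simp

theorem tsum_two_rpow_neg_abs_ne_top {ε : ℝ} (hε : 0 < ε) :
    ∑' l : ℤ, (2 : ℝ≥0∞) ^ (-(|(l : ℝ)| * ε)) ≠ ∞ := by
  have hx : (2 : ℝ≥0∞) ^ (-ε) < 1 :=
    ENNReal.rpow_lt_one_of_one_lt_of_neg (by norm_num) (by linarith)
  have hg : ∑' n : ℕ, ((2 : ℝ≥0∞) ^ (-ε)) ^ n ≠ ∞ := by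
    rw [ENNReal.tsum_geometric]
    exact ENNReal.inv_ne_top.2 (tsub_pos_of_lt hx).ne'
  rw [tsum_of_nat_of_neg_add_one ENNReal.summable ENNReal.summable]
  refine ENNReal.add_ne_top.2 ⟨?_, ?_⟩
  · refine ne_top_of_le_ne_top hg (ENNReal.tsum_le_tsum fun n => ?_)
    rw [← ENNReal.rpow_mul_natCast]
    refine two_rpow_mono ?_
    rw [Int.cast_natCast, abs_of_nonneg (by positivity)]
    linarith
  · refine ne_top_of_le_ne_top hg (ENNReal.tsum_le_tsum fun n => ?_)
    rw [← ENNReal.rpow_mul_natCast]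
    refine two_rpow_mono ?_
    have : |((-((n : ℤ) + 1) : ℤ) : ℝ)| = (n : ℝ) + 1 := by
      push_cast
      rw [abs_neg, abs_of_nonneg (by positivity)]
    rw [this]
    nlinarith

/-- A sum over a window of integers. -/
theorem tsum_window_le {x : ℤ → ℝ≥0∞} {c : ℝ≥0∞} (j : ℤ) (m : ℕ)
    (h : ∀ l, |j - l| ≤ m → x l ≤ c) :
    ∑' l : ℤ, (if |j - l| ≤ m then x l else 0) ≤ (2 * m + 1 : ℕ) * c := by
  rw [tsum_eq_sum (s := Finset.Icc (j - m) (j + m))]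
  · calc _ ≤ ∑ _l ∈ Finset.Icc (j - m) (j + m), c := by
          refine Finset.sum_le_sum fun l _ => ?_
          split_ifs with hl
          · exact h l hl
          · exact zero_le
      _ = _ := by
          rw [Finset.sum_const, nsmul_eq_mul, Int.card_Icc]
          congr 2
          omega
  · intro l hl
    rw [if_neg]
    intro h'
    rw [abs_le] at h'
    refine hl (Finset.mem_Icc.2 ⟨?_, ?_⟩) <;> omega

/-- The weight `2^{lN/2}` at low frequencies and `2^{-2nl}` at high frequencies. -/
def freqWeight (N n : ℕ) (l : ℤ) : ℝ≥0∞ :=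
  if l ≤ 0 then (2 : ℝ≥0∞) ^ ((l : ℝ) * (N / 2)) else (2 : ℝ≥0∞) ^ ((l : ℝ) * (-(2 * n)))

/-- The lower bound on s gives decay as l → -∞ and the upper bound as l → +∞; the common rate is the
smaller of the two margins. -/
theorem tsum_freqWeight_ne_top {N n : ℕ} {s : ℝ} (h1 : -((N : ℝ) / 2) < s) (h2 : s < 2 * n) :
    ∑' l : ℤ, freqWeight N n l * (2 : ℝ≥0∞) ^ ((l : ℝ) * s) ≠ ∞ := by
  set ε := min (s + N / 2) (2 * n - s)
  have hε : 0 < ε := lt_min (by linarith) (by linarith)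
  refine ne_top_of_le_ne_top (tsum_two_rpow_neg_abs_ne_top hε)
    (ENNReal.tsum_le_tsum fun l => ?_)
  rw [freqWeight]
  split_ifs with hl
  · rw [← two_rpow_add]
    refine two_rpow_mono ?_
    have hl' : (l : ℝ) ≤ 0 := by exact_mod_cast hl
    rw [abs_of_nonpos hl']
    have := min_le_left (s + N / 2) (2 * n - s)
    nlinarith
  · rw [← two_rpow_add]
    refine two_rpow_mono ?_
    have hl' : (0 : ℝ) < l := by exact_mod_cast not_le.1 hl
    rw [abs_of_pos hl']
    have := min_le_right (s + N / 2) (2 * n - s)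
    nlinarith

end Sums

/-! ### Series of tempered distributions -/

section Series

variable {N : ℕ} {ι : Type*}

/-- A series of tempered distributions that is dominated on test functions converges. -/
theorem exists_hasSum_of_enorm_le {P : ι → 𝓢'(RN N, ℂ)} {c : ι → ℝ≥0∞} (hc : ∑' i, c i ≠ ∞)
    {Q : 𝓢(RN N, ℂ) → ℝ≥0∞} (hQ : IsTestBound Q) (h : ∀ i ψ, ‖P i ψ‖ₑ ≤ c i * Q ψ) :
    ∃ w, HasSum P w := by
  have hle : ∀ ψ, ∑' i, ‖P i ψ‖ₑ ≤ (∑' i, c i) * Q ψ := fun ψ => by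
    rw [← ENNReal.tsum_mul_right]
    exact ENNReal.tsum_le_tsum fun i => h i ψ
  have hs : ∀ ψ, Summable fun i => P i ψ := fun ψ =>
    Summable.of_enorm (ne_top_of_le_ne_top (ENNReal.mul_ne_top hc (hQ.ne_top ψ)) (hle ψ))
  let L : 𝓢(RN N, ℂ) →ₗ[ℂ] ℂ :=
    { toFun := fun ψ => ∑' i, P i ψ
      map_add' := fun ψ η => by
        simp only [map_add]
        exact (hs ψ).tsum_add (hs η)
      map_smul' := fun z ψ => by
        simp only [map_smul, smul_eq_mul, RingHom.id_apply]
        exact tsum_mul_left }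
  have hL : Continuous L := by
    refine continuous_of_continuousAt_zero L ?_
    rw [ContinuousAt, map_zero, tendsto_zero_iff_enorm_tendsto_zero]
    have h0 : Filter.Tendsto (fun ψ => (∑' i, c i) * Q ψ) (nhds 0) (nhds 0) := by
      have := (ENNReal.continuous_const_mul hc).comp hQ.continuous
      have := this.tendsto 0
      simpa [hQ.map_zero, Function.comp_def] using this
    refine tendsto_of_tendsto_of_tendsto_of_le_of_le tendsto_const_nhds h0
      (fun _ => zero_le) fun ψ => ?_
    exact enorm_tsum_le_tsum_enorm.trans (hle ψ)
  refine ⟨ContinuousLinearMap.toPointwiseConvergenceCLM ℂ (RingHom.id ℂ) 𝓢(RN N, ℂ) ℂ ⟨L, hL⟩, ?_⟩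
  rw [HasSum, PointwiseConvergenceCLM.tendsto_iff_forall_tendsto]
  intro ψ
  have := (hs ψ).hasSum
  rw [HasSum] at this
  refine Filter.Tendsto.congr (fun s => ?_) this
  simp

theorem IsGivenBy.unique {u v : 𝓢'(RN N, ℂ)} {h : RN N → ℂ} (hu : IsGivenBy u h)
    (hv : IsGivenBy v h) : u = v := by
  ext ψ
  rw [hu.apply_eq, hv.apply_eq]

theorem isGivenBy_zero : IsGivenBy (0 : 𝓢'(RN N, ℂ)) fun _ => 0 where
  locallyIntegrable := locallyIntegrable_zero
  integrable ψ := by simp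
  apply_eq ψ := by simp

/-- The triangle inequality for a series of tempered distributions given by `L^p` functions. -/
theorem lpNorm_le_tsum {p : ℝ≥0∞} [Fact (1 ≤ p)] {P : ι → 𝓢'(RN N, ℂ)} {w : 𝓢'(RN N, ℂ)}
    (hw : HasSum P w) {h : ι → RN N → ℂ} (hP : ∀ i, IsGivenBy (P i) (h i))
    (hh : ∀ i, MemLp (h i) p volume) (hs : ∑' i, eLpNorm (h i) p volume ≠ ∞) :
    lpNorm p w ≤ ∑' i, eLpNorm (h i) p volume := by
  have he : ∀ i, ‖(hh i).toLp (h i)‖ₑ = eLpNorm (h i) p volume := fun i => by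
    rw [Lp.enorm_def, eLpNorm_congr_ae (hh i).coeFn_toLp]
  -- The series converges absolutely in L^p. The embedding into tempered distributions is
  -- continuous, so uniqueness of sums identifies the L^p limit with w.
  have hsum : Summable fun i => (hh i).toLp (h i) := by
    refine Summable.of_enorm ?_
    simpa only [he] using hs
  have hT := hsum.hasSum.map (Lp.toTemperedDistributionCLM ℂ (volume : Measure (RN N)) p)
    (Lp.toTemperedDistributionCLM ℂ (volume : Measure (RN N)) p).continuous
  have hPT : (⇑(Lp.toTemperedDistributionCLM ℂ (volume : Measure (RN N)) p) ∘
      fun i => (hh i).toLp (h i)) = P := by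
    funext i
    exact (isGivenBy_toTemperedDistribution (hh i)).unique (hP i)
  rw [hPT] at hT
  have hwS := hw.unique hT
  have hg := isGivenBy_toTemperedDistribution (Lp.memLp (∑' i, (hh i).toLp (h i)))
  rw [Lp.toLp_coeFn] at hg
  have hg' : IsGivenBy w (∑' i, (hh i).toLp (h i) : Lp ℂ p (volume : Measure (RN N))) := by
    rw [hwS]
    exact hg
  rw [hg'.lpNorm_eq, ← Lp.enorm_def]
  refine enorm_tsum_le_tsum_enorm.trans (le_of_eq ?_)
  simp only [he]

end Series

/-! ### Existence of the product and bounds for its blocks -/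

section Product

variable {N : ℕ} {φ : 𝓢(RN N, ℂ)}

/-- Functions that give the frequency blocks of `f` and are in `L^a`. -/
structure IsBlockFamily (φ : 𝓢(RN N, ℂ)) (a : ℝ) (f : 𝓢'(RN N, ℂ)) (F : ℤ → RN N → ℂ) : Prop where
  isGivenBy : ∀ k, IsGivenBy (dyadicBlock φ k f) (F k)
  memLp : ∀ k, MemLp (F k) (ENNReal.ofReal a) volume

/-- The sums of products of blocks that control the paraproducts (`low`, `high`) and the
remainder (`diag`) of Bony's decomposition. -/
structure ProductBounds (F G : ℤ → RN N → ℂ) (r σ τ : ℝ) (A B R : ℝ≥0∞) : Prop where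
  low : ∀ l : ℤ, ∑' k : ℤ, (if k ≤ l + 3 then eLpNorm (fun x => F k x * G l x) 2 volume else 0) ≤
    A * (2 : ℝ≥0∞) ^ ((l : ℝ) * σ)
  high : ∀ k : ℤ, ∑' l : ℤ, (if l ≤ k + 3 then eLpNorm (fun x => F k x * G l x) 2 volume else 0) ≤
    B * (2 : ℝ≥0∞) ^ ((k : ℝ) * τ)
  diag : ∀ j : ℤ, ∑' q : ℤ × ℤ, (if |q.1 - q.2| ≤ 3 ∧ j ≤ q.2 + 5 then
      eLpNorm (fun x => F q.1 x * G q.2 x) (ENNReal.ofReal r) volume else 0) ≤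
    R * (2 : ℝ≥0∞) ^ ((j : ℝ) * (σ - N * (r⁻¹ - 2⁻¹)))
  low_ne_top : A ≠ ∞
  high_ne_top : B ≠ ∞
  diag_ne_top : R ≠ ∞

variable {F G : ℤ → RN N → ℂ} {a b r σ τ : ℝ} {A B R : ℝ≥0∞} {f g : 𝓢'(RN N, ℂ)}

theorem IsBlockFamily.aestronglyMeasurable_mul (hF : IsBlockFamily φ a f F)
    (hG : IsBlockFamily φ b g G) (k l : ℤ) :
    AEStronglyMeasurable (fun x => F k x * G l x) volume :=
  (hF.memLp k).1.mul (hG.memLp l).1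

theorem ProductBounds.memLp_two (h : ProductBounds F G r σ τ A B R) (hF : IsBlockFamily φ a f F)
    (hG : IsBlockFamily φ b g G) (k l : ℤ) : MemLp (fun x => F k x * G l x) 2 volume := by
  refine ⟨hF.aestronglyMeasurable_mul hG k l, ?_⟩
  rcases le_or_gt k (l + 3) with hkl | hkl
  · refine lt_of_le_of_lt ?_ (lt_of_le_of_lt (h.low l)
      (ENNReal.mul_lt_top h.low_ne_top.lt_top (two_rpow_ne_top _).lt_top))
    refine le_trans ?_ (ENNReal.le_tsum k)
    rw [if_pos hkl]
  · refine lt_of_le_of_lt ?_ (lt_of_le_of_lt (h.high k)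
      (ENNReal.mul_lt_top h.high_ne_top.lt_top (two_rpow_ne_top _).lt_top))
    refine le_trans ?_ (ENNReal.le_tsum l)
    rw [if_pos (by omega)]

theorem ProductBounds.memLp_diag (h : ProductBounds F G r σ τ A B R) (hF : IsBlockFamily φ a f F)
    (hG : IsBlockFamily φ b g G) {k l : ℤ} (hkl : |k - l| ≤ 3) :
    MemLp (fun x => F k x * G l x) (ENNReal.ofReal r) volume := by
  refine ⟨hF.aestronglyMeasurable_mul hG k l, ?_⟩
  refine lt_of_le_of_lt ?_ (lt_of_le_of_lt (h.diag l)
      (ENNReal.mul_lt_top h.diag_ne_top.lt_top (two_rpow_ne_top _).lt_top))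
  refine le_trans ?_ (ENNReal.le_tsum (k, l))
  rw [if_pos ⟨hkl, by simp⟩]

/-- The weight depends only on the dominant index, so the inner sum can be done first. It serves
twice: with `freqWeight` for convergence, and with the indicator of a window for spectral
localization. -/
theorem tsum_prod_low_mul {π : ℤ → ℤ → ℝ≥0∞} {W : ℤ → ℝ≥0∞} {c : ℤ → ℝ≥0∞}
    (h : ∀ l, ∑' k, (if k ≤ l + 3 then π k l else 0) ≤ c l) :
    ∑' q : ℤ × ℤ, (if q.1 ≤ q.2 + 3 then π q.1 q.2 else 0) * W q.2 ≤ ∑' l, c l * W l := by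
  rw [ENNReal.tsum_prod (f := fun k l => (if k ≤ l + 3 then π k l else 0) * W l),
    ENNReal.tsum_comm]
  refine ENNReal.tsum_le_tsum fun l => ?_
  rw [ENNReal.tsum_mul_right]
  gcongr
  exact h l

theorem tsum_prod_high_mul {π : ℤ → ℤ → ℝ≥0∞} {W : ℤ → ℝ≥0∞} {c : ℤ → ℝ≥0∞}
    (h : ∀ k, ∑' l, (if l ≤ k + 3 then π k l else 0) ≤ c k) :
    ∑' q : ℤ × ℤ, (if q.2 ≤ q.1 + 3 then π q.1 q.2 else 0) * W q.1 ≤ ∑' k, c k * W k := by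
  rw [ENNReal.tsum_prod (f := fun k l => (if l ≤ k + 3 then π k l else 0) * W k)]
  refine ENNReal.tsum_le_tsum fun k => ?_
  rw [ENNReal.tsum_mul_right]
  gcongr
  exact h k

/-- Under summability of the products of blocks, the product of two distributions exists. -/
theorem ProductBounds.exists_isProduct (h : ProductBounds F G r σ τ A B R)
    (hφ : IsDyadicGenerator φ) (ha : 1 ≤ a) (hb : 1 ≤ b) (hr : 1 ≤ r) (hσ : -((N : ℝ) / 2) < σ)
    (hτ : σ ≤ τ) (hF : IsBlockFamily φ a f F) (hG : IsBlockFamily φ b g G) :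
    ∃ (w : 𝓢'(RN N, ℂ)) (P : ℤ × ℤ → 𝓢'(RN N, ℂ)),
      (∀ q, IsGivenBy (P q) fun x => F q.1 x * G q.2 x) ∧ HasSum P w := by
  -- Since σ ≤ τ < 2n, the decay 2^{-2nl} beats the growth of both paraproducts.
  obtain ⟨n, hn⟩ := exists_nat_gt (τ / 2)
  have hP2 := h.memLp_two hF hG
  have hP : ∀ q : ℤ × ℤ, IsGivenBy (Lp.toTemperedDistribution ((hP2 q.1 q.2).toLp _) : 𝓢'(RN N, ℂ))
      fun x => F q.1 x * G q.2 x := fun q => isGivenBy_toTemperedDistribution (hP2 q.1 q.2)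
  obtain ⟨Q₁, hQ₁, h₁⟩ := exists_pairing_low hφ ha
  obtain ⟨Q₂, hQ₂, h₂⟩ := exists_pairing_high hφ ha n
  obtain ⟨Q₃, hQ₃, h₃⟩ := exists_pairing_low hφ hb
  obtain ⟨Q₄, hQ₄, h₄⟩ := exists_pairing_high hφ hb n
  have hr1 : 1 ≤ ENNReal.ofReal r := by simpa using hr
  have hconj := ENNReal.HolderConjugate.inv_one_sub_inv' hr1
  set r' := (1 - (ENNReal.ofReal r)⁻¹)⁻¹
  have hr' : Fact (1 ≤ r') := by simp [fact_iff, r']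
  have hQ₅ := isTestBound_eLpNorm (ContinuousLinearMap.id ℂ 𝓢(RN N, ℂ)) 1 r'
  set Q₅ : 𝓢(RN N, ℂ) → ℝ≥0∞ := fun ψ =>
    (1 : ℝ≥0) * eLpNorm (ContinuousLinearMap.id ℂ 𝓢(RN N, ℂ) ψ) r' volume with hQ₅_def
  have hQ := (((hQ₁.add hQ₂).add hQ₃).add hQ₄).add hQ₅
  set Q := fun ψ => Q₁ ψ + Q₂ ψ + Q₃ ψ + Q₄ ψ + Q₅ ψ with hQ_def
  set π : ℤ → ℤ → ℝ≥0∞ := fun k l => eLpNorm (fun x => F k x * G l x) 2 volume with hπ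
  -- The first two terms weight a pair by its dominant frequency. They do not cover comparable high
  -- frequencies, whose product may reach frequency zero and gains no decay from ψ; the third term
  -- pairs these in L^r against L^{r'}.
  let c : ℤ × ℤ → ℝ≥0∞ := fun q =>
    (if q.1 ≤ q.2 + 3 then π q.1 q.2 else 0) * freqWeight N n q.2 +
    (if q.2 ≤ q.1 + 3 then π q.1 q.2 else 0) * freqWeight N n q.1 +
    (if |q.1 - q.2| ≤ 3 ∧ 0 ≤ q.2 + 5 then
      eLpNorm (fun x => F q.1 x * G q.2 x) (ENNReal.ofReal r) volume else 0)
  have hw : ∀ s D, D ≠ ∞ → σ ≤ s → s ≤ τ →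
      ∑' l : ℤ, (D * (2 : ℝ≥0∞) ^ ((l : ℝ) * s)) * freqWeight N n l ≠ ∞ := by
    intro s D hD hs hs'
    have e : ∀ l : ℤ, (D * (2 : ℝ≥0∞) ^ ((l : ℝ) * s)) * freqWeight N n l =
        D * (freqWeight N n l * (2 : ℝ≥0∞) ^ ((l : ℝ) * s)) := fun l => by ring
    simp_rw [e]
    rw [ENNReal.tsum_mul_left]
    exact ENNReal.mul_ne_top hD (tsum_freqWeight_ne_top (by linarith) (by linarith))
  have hc : ∑' q, c q ≠ ∞ := by
    simp only [c]
    rw [ENNReal.tsum_add, ENNReal.tsum_add]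
    refine ENNReal.add_ne_top.2 ⟨ENNReal.add_ne_top.2 ⟨?_, ?_⟩, ?_⟩
    · exact ne_top_of_le_ne_top (hw σ A h.low_ne_top le_rfl hτ) (tsum_prod_low_mul h.low)
    · exact ne_top_of_le_ne_top (hw τ B h.high_ne_top hτ le_rfl) (tsum_prod_high_mul h.high)
    · exact ne_top_of_le_ne_top (ENNReal.mul_ne_top h.diag_ne_top (two_rpow_ne_top _)) (h.diag 0)
  obtain ⟨w, hw⟩ := exists_hasSum_of_enorm_le
    (P := fun q : ℤ × ℤ => (Lp.toTemperedDistribution ((hP2 q.1 q.2).toLp _) : 𝓢'(RN N, ℂ)))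
    hc hQ (by
      rintro ⟨k, l⟩ ψ
      rw [(hP (k, l)).apply_eq]
      simp only
      have hswap : ∫ x, ψ x * (F k x * G l x) = ∫ x, ψ x * (G l x * F k x) := by
        simp_rw [mul_comm (F k _)]
      have hπ' : π k l = eLpNorm (fun x => G l x * F k x) 2 volume := by
        simp only [hπ, mul_comm]
      have hP2' : MemLp (fun x => G l x * F k x) 2 volume := by
        simpa only [mul_comm] using hP2 k l
      have hfin : ∀ x y : ℝ≥0∞, x ≤ c (k, l) → y ≤ Q ψ → x * y ≤ c (k, l) * Q ψ :=
        fun x y hx hy => mul_le_mul' hx hy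
      by_cases hkl : k ≤ l + 3
      · have hcl : π k l * freqWeight N n l ≤ c (k, l) := by
          simp only [c]
          rw [if_pos hkl, add_assoc]
          exact le_self_add
        by_cases hl : l ≤ 0
        · refine (h₁ f g k l (F k) (G l) (hF.isGivenBy k) (hF.memLp k) (hG.isGivenBy l) (hP2 k l)
            hkl ψ).trans (hfin _ _ ?_ ?_)
          · rwa [freqWeight, if_pos hl] at hcl
          · simp only [hQ_def, add_assoc]
            exact le_self_add
        · by_cases hkl' : k ≤ l - 4
          · refine (h₂ f g k l (F k) (G l) (hF.isGivenBy k) (hF.memLp k) (hG.isGivenBy l)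
              (hP2 k l) hkl' ψ).trans (hfin _ _ ?_ ?_)
            · rwa [freqWeight, if_neg hl] at hcl
            · simp only [hQ_def, add_assoc]
              exact le_add_left le_self_add
          · have hd : |k - l| ≤ 3 := abs_le.2 ⟨by omega, by omega⟩
            have := enorm_integral_mul_le (p := r') (q := ENNReal.ofReal r)
              ψ.continuous.aestronglyMeasurable (h.memLp_diag hF hG hd).1
            rw [mul_comm] at this
            refine this.trans (hfin _ _ ?_ ?_)
            · simp only [c]
              rw [if_pos (⟨hd, by omega⟩ : |k - l| ≤ 3 ∧ 0 ≤ l + 5)]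
              exact le_add_self
            · simp only [hQ_def, hQ₅_def, ENNReal.coe_one, one_mul, ContinuousLinearMap.id_apply]
              exact le_add_self
      · have hlk : l ≤ k + 3 := by omega
        have hlk' : l ≤ k - 4 := by omega
        have hcl : π k l * freqWeight N n k ≤ c (k, l) := by
          simp only [c]
          rw [if_pos hlk, add_right_comm]
          exact le_add_self
        rw [hswap]
        rw [hπ'] at hcl
        by_cases hk : k ≤ 0
        · refine (h₃ g f l k (G l) (F k) (hG.isGivenBy l) (hG.memLp l) (hF.isGivenBy k) hP2'
            hlk ψ).trans (hfin _ _ ?_ ?_)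
          · rwa [freqWeight, if_pos hk] at hcl
          · simp only [hQ_def]
            exact le_add_right (le_add_right le_add_self)
        · refine (h₄ g f l k (G l) (F k) (hG.isGivenBy l) (hG.memLp l) (hF.isGivenBy k) hP2'
            hlk' ψ).trans (hfin _ _ ?_ ?_)
          · rwa [freqWeight, if_neg hk] at hcl
          · simp only [hQ_def]
            exact le_add_right le_add_self)
  exact ⟨w, _, hP, hw⟩

/-- Five indices contribute, and each weight differs from the central one by a factor of at most
2^{2|s|}. -/
theorem tsum_window_rpow_le (D : ℝ≥0∞) (s : ℝ) (j : ℤ) :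
    ∑' l : ℤ, (D * (2 : ℝ≥0∞) ^ ((l : ℝ) * s)) * (if |j - l| ≤ 2 then 1 else 0) ≤
      5 * (2 : ℝ≥0∞) ^ (2 * |s|) * (D * (2 : ℝ≥0∞) ^ ((j : ℝ) * s)) := by
  simp only [mul_ite, mul_one, mul_zero]
  have := tsum_window_le (x := fun l : ℤ => D * (2 : ℝ≥0∞) ^ ((l : ℝ) * s))
    (c := (2 : ℝ≥0∞) ^ (2 * |s|) * (D * (2 : ℝ≥0∞) ^ ((j : ℝ) * s))) j 2 ?_
  · refine this.trans (le_of_eq ?_)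
    push_cast
    ring
  · intro l hl
    rw [mul_left_comm, ← two_rpow_add]
    gcongr
    · norm_num
    have h1 : |((l : ℝ) - j)| ≤ 2 := by
      rw [abs_sub_comm]
      exact_mod_cast hl
    have h2 : ((l : ℝ) - j) * s ≤ |(l : ℝ) - j| * |s| := by
      rw [← abs_mul]
      exact le_abs_self _
    nlinarith [abs_nonneg s]

/-- The `L^2` bounds for the frequency blocks of a product. -/
theorem exists_product_bound (hφ : IsDyadicGenerator φ) (ha : 1 ≤ a) (hb : 1 ≤ b) (hr : 1 ≤ r)
    (hr2 : r ≤ 2) (hσ : -((N : ℝ) / 2) < σ) (hτ : σ ≤ τ) :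
    ∃ C : ℝ≥0, ∀ (f g : 𝓢'(RN N, ℂ)) (F G : ℤ → RN N → ℂ) (A B R : ℝ≥0∞),
      IsBlockFamily φ a f F → IsBlockFamily φ b g G → ProductBounds F G r σ τ A B R →
      ∃ w, IsProduct φ f g w ∧ ∀ j : ℤ, lpNorm 2 (dyadicBlock φ j w) ≤
        C * (A + R) * (2 : ℝ≥0∞) ^ ((j : ℝ) * σ) + C * B * (2 : ℝ≥0∞) ^ ((j : ℝ) * τ) := by
  obtain ⟨C₂, hC₂⟩ := exists_eLpNorm_kernelConv_dilate_le φ (a := 2) (b := 2) (by norm_num)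
    (by simp)
  obtain ⟨Cr, hCr⟩ := exists_eLpNorm_kernelConv_dilate_le φ (a := r) (b := 2) hr
    (by rw [ENNReal.ofReal_le_iff_le_toReal (by norm_num)]; simpa using hr2)
  have hC₂' : ∀ (j : ℤ) (h : RN N → ℂ), MemLp h 2 volume →
      eLpNorm (kernelConv (𝓕 (dilate j φ)) h) 2 volume ≤ C₂ * eLpNorm h 2 volume := by
    intro j h hh
    have := hC₂ j h (by simpa using hh)
    simpa using this
  let D : ℝ≥0∞ := C₂ * (5 * (2 : ℝ≥0∞) ^ (2 * |σ|) + 5 * (2 : ℝ≥0∞) ^ (2 * |τ|)) + Cr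
  have hD : D ≠ ∞ := by
    simp only [D]
    finiteness
  refine ⟨D.toNNReal, fun f g F G A B R hF hG h => ?_⟩
  rw [ENNReal.coe_toNNReal hD]
  obtain ⟨w, P, hP, hw⟩ := h.exists_isProduct hφ ha hb hr hσ hτ hF hG
  refine ⟨w, ⟨F, G, P, hF.isGivenBy, hG.isGivenBy, hP, hw⟩, fun j => ?_⟩
  have hP2 := h.memLp_two hF hG
  set π : ℤ → ℤ → ℝ≥0∞ := fun k l => eLpNorm (fun x => F k x * G l x) 2 volume with hπ
  let H : ℤ × ℤ → RN N → ℂ := fun q =>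
    kernelConv (𝓕 (dilate j φ)) fun x => F q.1 x * G q.2 x
  have hH : ∀ q, IsGivenBy (dyadicBlock φ j (P q)) (H q) := fun q => by
    rw [dyadicBlock_eq]
    exact (hP q).fourierMultiplier (dilate j φ) (a := 2) (by norm_num)
      (by simpa using hP2 q.1 q.2)
  have hH2 : ∀ q, MemLp (H q) 2 volume := fun q =>
    ⟨aestronglyMeasurable_kernelConv _ (hP2 q.1 q.2).1, (hC₂' j _ (hP2 q.1 q.2)).trans_lt
      (ENNReal.mul_lt_top ENNReal.coe_lt_top (hP2 q.1 q.2).2)⟩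
  have hzero : ∀ q, dyadicBlock φ j (P q) = 0 → eLpNorm (H q) 2 volume = 0 := fun q hq => by
    have hq' := hH q
    rw [hq] at hq'
    rw [eLpNorm_congr_ae (hq'.ae_eq isGivenBy_zero)]
    simp
  have hsumw : HasSum (fun q => dyadicBlock φ j (P q)) (dyadicBlock φ j w) :=
    hw.map (dyadicBlock φ j) (dyadicBlock φ j).continuous
  let W : ℤ → ℝ≥0∞ := fun l => if |j - l| ≤ 2 then 1 else 0
  -- Separated pairs are seen at j only within distance 2 of the dominant index, comparable pairs
  -- only for j ≤ l + 5. The latter pass from L^r to L^2 at the cost 2^{jN(1/r-1/2)}, which restores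
  -- the exponent σ from `h.diag`.
  let d : ℤ × ℤ → ℝ≥0∞ := fun q =>
    C₂ * ((if q.1 ≤ q.2 + 3 then π q.1 q.2 else 0) * W q.2) +
    C₂ * ((if q.2 ≤ q.1 + 3 then π q.1 q.2 else 0) * W q.1) +
    Cr * (2 : ℝ≥0∞) ^ ((j : ℝ) * (N * (r⁻¹ - 2⁻¹))) *
      (if |q.1 - q.2| ≤ 3 ∧ j ≤ q.2 + 5 then
        eLpNorm (fun x => F q.1 x * G q.2 x) (ENNReal.ofReal r) volume else 0)
  have hd : ∀ q, eLpNorm (H q) 2 volume ≤ d q := by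
    rintro ⟨k, l⟩
    have hswap : IsGivenBy (P (k, l)) fun x => G l x * F k x := by
      simpa only [mul_comm] using hP (k, l)
    by_cases hkl : k ≤ l - 4
    · by_cases hj : |j - l| ≤ 2
      · refine (hC₂' j _ (hP2 k l)).trans ?_
        simp only [d, W]
        rw [if_pos (by omega : k ≤ l + 3), if_pos hj, mul_one, add_assoc]
        exact le_self_add
      · rw [hzero (k, l) (block_eq_zero_of_lt hφ (hF.isGivenBy k) ha (hF.memLp k)
          (hG.isGivenBy l) (hP (k, l)) hkl (not_le.1 hj))]
        exact zero_le
    by_cases hlk : l ≤ k - 4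
    · by_cases hj : |j - k| ≤ 2
      · refine (hC₂' j _ (hP2 k l)).trans ?_
        simp only [d, W]
        rw [if_pos (by omega : l ≤ k + 3), if_pos hj, mul_one, add_right_comm]
        exact le_add_self
      · rw [hzero (k, l) (block_eq_zero_of_lt hφ (hG.isGivenBy l) hb (hG.memLp l)
          (hF.isGivenBy k) hswap hlk (not_le.1 hj))]
        exact zero_le
    · have hdiag : |k - l| ≤ 3 := abs_le.2 ⟨by omega, by omega⟩
      by_cases hj : j ≤ l + 5
      · refine (hCr j _ (h.memLp_diag hF hG hdiag)).trans ?_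
        simp only [d, W]
        rw [if_pos (⟨hdiag, hj⟩ : |k - l| ≤ 3 ∧ j ≤ l + 5)]
        exact le_add_self
      · rw [hzero (k, l) (block_eq_zero_of_le hφ (hF.isGivenBy k) ha (hF.memLp k)
          (hG.isGivenBy l) (hP (k, l)) (by omega) (not_le.1 hj))]
        exact zero_le
  have hdsum : ∑' q, d q ≤ D * (A + R) * (2 : ℝ≥0∞) ^ ((j : ℝ) * σ) +
      D * B * (2 : ℝ≥0∞) ^ ((j : ℝ) * τ) := by
    have s1 := (tsum_prod_low_mul (W := W) h.low).trans (tsum_window_rpow_le A σ j)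
    have s2 := (tsum_prod_high_mul (W := W) h.high).trans (tsum_window_rpow_le B τ j)
    have s3 : (2 : ℝ≥0∞) ^ ((j : ℝ) * (N * (r⁻¹ - 2⁻¹))) *
        ∑' q : ℤ × ℤ, (if |q.1 - q.2| ≤ 3 ∧ j ≤ q.2 + 5 then
          eLpNorm (fun x => F q.1 x * G q.2 x) (ENNReal.ofReal r) volume else 0) ≤
        R * (2 : ℝ≥0∞) ^ ((j : ℝ) * σ) := by
      calc _ ≤ (2 : ℝ≥0∞) ^ ((j : ℝ) * (N * (r⁻¹ - 2⁻¹))) *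
            (R * (2 : ℝ≥0∞) ^ ((j : ℝ) * (σ - N * (r⁻¹ - 2⁻¹)))) := by
              gcongr
              exact h.diag j
        _ = _ := by
          rw [mul_left_comm, ← two_rpow_add]
          congr 2
          ring
    simp only [d]
    rw [ENNReal.tsum_add, ENNReal.tsum_add, ENNReal.tsum_mul_left, ENNReal.tsum_mul_left,
      ENNReal.tsum_mul_left, mul_assoc (Cr : ℝ≥0∞)]
    have hD1 : C₂ * (5 * (2 : ℝ≥0∞) ^ (2 * |σ|)) ≤ D := by
      simp only [D, mul_add, add_assoc]
      exact le_self_add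
    have hD2 : C₂ * (5 * (2 : ℝ≥0∞) ^ (2 * |τ|)) ≤ D := by
      simp only [D, mul_add]
      rw [add_right_comm]
      exact le_add_self
    have hD3 : (Cr : ℝ≥0∞) ≤ D := le_add_self
    calc _ ≤ C₂ * (5 * (2 : ℝ≥0∞) ^ (2 * |σ|) * (A * (2 : ℝ≥0∞) ^ ((j : ℝ) * σ))) +
          C₂ * (5 * (2 : ℝ≥0∞) ^ (2 * |τ|) * (B * (2 : ℝ≥0∞) ^ ((j : ℝ) * τ))) +
          Cr * (R * (2 : ℝ≥0∞) ^ ((j : ℝ) * σ)) := by gcongr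
      _ = (C₂ * (5 * (2 : ℝ≥0∞) ^ (2 * |σ|))) * (A * (2 : ℝ≥0∞) ^ ((j : ℝ) * σ)) +
          (C₂ * (5 * (2 : ℝ≥0∞) ^ (2 * |τ|))) * (B * (2 : ℝ≥0∞) ^ ((j : ℝ) * τ)) +
          Cr * (R * (2 : ℝ≥0∞) ^ ((j : ℝ) * σ)) := by ring
      _ ≤ D * (A * (2 : ℝ≥0∞) ^ ((j : ℝ) * σ)) + D * (B * (2 : ℝ≥0∞) ^ ((j : ℝ) * τ)) +
          D * (R * (2 : ℝ≥0∞) ^ ((j : ℝ) * σ)) := by gcongr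
      _ = _ := by ring
  have hle := ENNReal.tsum_le_tsum hd
  refine (lpNorm_le_tsum hsumw hH hH2 ?_).trans (hle.trans hdsum)
  refine ne_top_of_le_ne_top ?_ (hle.trans hdsum)
  have := h.low_ne_top
  have := h.high_ne_top
  have := h.diag_ne_top
  finiteness

end Product

/-! ### Besov norms in terms of blocks -/

section Besov

variable {N : ℕ} {φ : 𝓢(RN N, ℂ)} {f g : 𝓢'(RN N, ℂ)} {s : ℝ} {p : ℝ≥0∞}

theorem besovNorm_one : besovNorm φ s p 1 f =
    ∑' k : ℤ, (2 : ℝ≥0∞) ^ ((k : ℝ) * s) * lpNorm p (dyadicBlock φ k f) := by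
  rw [besovNorm, eLpNorm_one_eq_lintegral_enorm, lintegral_count]
  simp

theorem le_besovNorm_top (k : ℤ) :
    (2 : ℝ≥0∞) ^ ((k : ℝ) * s) * lpNorm p (dyadicBlock φ k f) ≤ besovNorm φ s p ∞ f := by
  rw [besovNorm, eLpNorm_exponent_top]
  have := enorm_ae_le_eLpNormEssSup
    (fun k : ℤ => (2 : ℝ≥0∞) ^ ((k : ℝ) * s) * lpNorm p (dyadicBlock φ k f)) Measure.count
  rw [Measure.ae_count_iff] at this
  simpa using this k

theorem besovNorm_top_le {c : ℝ≥0∞}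
    (h : ∀ k : ℤ, (2 : ℝ≥0∞) ^ ((k : ℝ) * s) * lpNorm p (dyadicBlock φ k f) ≤ c) :
    besovNorm φ s p ∞ f ≤ c := by
  rw [besovNorm, eLpNorm_exponent_top]
  refine eLpNormEssSup_le_of_ae_enorm_bound (Filter.Eventually.of_forall fun k => ?_)
  simpa using h k

theorem besovNormLow_top_le {k₀ : ℤ} {c : ℝ≥0∞}
    (h : ∀ k ≤ k₀, (2 : ℝ≥0∞) ^ ((k : ℝ) * s) * lpNorm p (dyadicBlock φ k f) ≤ c) :
    besovNormLow φ k₀ s p ∞ f ≤ c := by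
  rw [besovNormLow, eLpNorm_exponent_top]
  refine eLpNormEssSup_le_of_ae_enorm_bound (Filter.Eventually.of_forall fun k => ?_)
  rw [enorm_eq_self]
  split_ifs with hk
  · exact h k hk
  · exact zero_le

theorem exists_isBlockFamily {a : ℝ} {Y : ℝ≥0∞} (hY : Y < ∞)
    (h : ∀ k : ℤ, (2 : ℝ≥0∞) ^ ((k : ℝ) * s) * lpNorm (ENNReal.ofReal a) (dyadicBlock φ k f) ≤ Y) :
    ∃ F, IsBlockFamily φ a f F := by
  have hk : ∀ k, lpNorm (ENNReal.ofReal a) (dyadicBlock φ k f) < ∞ := fun k =>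
    ENNReal.lt_top_of_mul_ne_top_right ((h k).trans_lt hY).ne (by simp)
  choose F h1 h2 using fun k => exists_isGivenBy_memLp (hk k)
  exact ⟨F, h1, h2⟩

theorem IsBlockFamily.lpNorm_eq {a : ℝ} {F : ℤ → RN N → ℂ} (hF : IsBlockFamily φ a f F) (k : ℤ)
    (p : ℝ≥0∞) : lpNorm p (dyadicBlock φ k f) = eLpNorm (F k) p volume :=
  (hF.isGivenBy k).lpNorm_eq p

end Besov

/-! ### The paraproduct and remainder sums -/

section Estimates

variable {N : ℕ} {φ : 𝓢(RN N, ℂ)} {p q α β : ℝ}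

theorem two_rpow_mul_cancel (x : ℝ) (y : ℝ≥0∞) : (2 : ℝ≥0∞) ^ (-x) * ((2 : ℝ≥0∞) ^ x * y) = y := by
  rw [← mul_assoc, ← two_rpow_add]
  simp

theorem le_two_rpow_neg_mul {x : ℝ} {y z : ℝ≥0∞} (h : (2 : ℝ≥0∞) ^ x * y ≤ z) :
    y ≤ (2 : ℝ≥0∞) ^ (-x) * z := by
  rw [← two_rpow_mul_cancel x y]
  gcongr

/-- The `L^2` norm of a product of blocks, with Bernstein's inequality applied to the first. -/
theorem exists_eLpNorm_mul_two_le (hφ : IsDyadicGenerator φ) (hp : 2 ≤ p) (hq : 2 ≤ q)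
    (hpq : 2⁻¹ ≤ p⁻¹ + q⁻¹) :
    ∃ C : ℝ≥0, ∀ (f g : 𝓢'(RN N, ℂ)) (F G : ℤ → RN N → ℂ), IsBlockFamily φ p f F →
      IsBlockFamily φ q g G → ∀ k l : ℤ, eLpNorm (fun x => F k x * G l x) 2 volume ≤
        C * ((2 : ℝ≥0∞) ^ ((k : ℝ) * (N * (p⁻¹ + q⁻¹ - 2⁻¹))) *
          eLpNorm (F k) (ENNReal.ofReal p) volume * eLpNorm (G l) (ENNReal.ofReal q) volume) := by
  have hp0 : 0 < p := by linarith
  have hq0 : 0 < q := by linarith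
  have hq2 : q⁻¹ ≤ 2⁻¹ := inv_anti₀ (by norm_num) hq
  -- The Hölder exponent with 1/b + 1/q = 1/2, equal to ∞ when q = 2. The hypothesis `hpq` says
  -- exactly that p ≤ b, as Bernstein requires.
  set b : ℝ≥0∞ := (ENNReal.ofReal (2⁻¹ - q⁻¹))⁻¹ with hb
  have h2 : (2 : ℝ≥0∞)⁻¹ = ENNReal.ofReal 2⁻¹ := by
    rw [ENNReal.ofReal_inv_of_pos (by norm_num), ENNReal.ofReal_ofNat]
  have hT : ENNReal.HolderTriple b (ENNReal.ofReal q) 2 := by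
    refine ⟨?_⟩
    rw [hb, inv_inv, ← ENNReal.ofReal_inv_of_pos hq0, ← ENNReal.ofReal_add (by linarith)
      (by positivity), h2]
    congr 1
    ring
  have hpb : ENNReal.ofReal p ≤ b := by
    rw [hb, ENNReal.le_inv_iff_le_inv, ← ENNReal.ofReal_inv_of_pos hp0]
    exact ENNReal.ofReal_le_ofReal (by linarith)
  have hbr : b.toReal⁻¹ = 2⁻¹ - q⁻¹ := by
    rw [hb, ENNReal.toReal_inv, inv_inv, ENNReal.toReal_ofReal (by linarith)]
  obtain ⟨C, hC⟩ := exists_bernstein hφ (by linarith : 1 ≤ p) hpb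
  refine ⟨C, fun f g F G hF hG k l => ?_⟩
  have h1 : eLpNorm (fun x => F k x * G l x) 2 volume ≤
      eLpNorm (F k) b volume * eLpNorm (G l) (ENNReal.ofReal q) volume :=
    eLpNorm_smul_le_mul_eLpNorm (p := b) (q := ENNReal.ofReal q) (r := 2) (f := G l) (φ := F k)
      (hG.memLp l).1 (hF.memLp k).1
  have h3 := hC f k (F k) (hF.isGivenBy k) (hF.memLp k)
  rw [hbr, show p⁻¹ - (2⁻¹ - q⁻¹) = p⁻¹ + q⁻¹ - 2⁻¹ by ring] at h3
  refine h1.trans ?_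
  rw [← mul_assoc, ← mul_assoc]
  gcongr

theorem eLpNorm_mul_le_of_inv_add_inv {F G : RN N → ℂ} (hp : 0 < p) (hq : 0 < q)
    (hF : AEStronglyMeasurable F volume) (hG : AEStronglyMeasurable G volume) :
    eLpNorm (fun x => F x * G x) (ENNReal.ofReal (p⁻¹ + q⁻¹)⁻¹) volume ≤
      eLpNorm F (ENNReal.ofReal p) volume * eLpNorm G (ENNReal.ofReal q) volume := by
  have hT : ENNReal.HolderTriple (ENNReal.ofReal p) (ENNReal.ofReal q)
      (ENNReal.ofReal (p⁻¹ + q⁻¹)⁻¹) := by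
    refine ⟨?_⟩
    rw [← ENNReal.ofReal_inv_of_pos hq, ← ENNReal.ofReal_inv_of_pos hp,
      ← ENNReal.ofReal_add (by positivity) (by positivity),
      ← ENNReal.ofReal_inv_of_pos (by positivity), inv_inv]
  exact eLpNorm_smul_le_mul_eLpNorm (p := ENNReal.ofReal p) (q := ENNReal.ofReal q)
    (r := ENNReal.ofReal (p⁻¹ + q⁻¹)⁻¹) (f := G) (φ := F) hG hF

/-- The sum that controls the paraproduct `T_f g`. -/
theorem exists_tsum_low_le (hφ : IsDyadicGenerator φ) (hp : 2 ≤ p) (hq : 2 ≤ q)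
    (hpq : 2⁻¹ ≤ p⁻¹ + q⁻¹) (hα : α ≤ N * (p⁻¹ + q⁻¹ - 2⁻¹)) :
    ∃ C : ℝ≥0, ∀ (f g : 𝓢'(RN N, ℂ)) (F G : ℤ → RN N → ℂ), IsBlockFamily φ p f F →
      IsBlockFamily φ q g G → ∀ l : ℤ,
      ∑' k : ℤ, (if k ≤ l + 3 then eLpNorm (fun x => F k x * G l x) 2 volume else 0) ≤
        C * (besovNorm φ α (ENNReal.ofReal p) 1 f * besovNorm φ β (ENNReal.ofReal q) ∞ g) *
          (2 : ℝ≥0∞) ^ ((l : ℝ) * (N * (p⁻¹ + q⁻¹ - 2⁻¹) - α - β)) := by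
  obtain ⟨C, hC⟩ := exists_eLpNorm_mul_two_le hφ hp hq hpq
  set ω := N * (p⁻¹ + q⁻¹ - 2⁻¹) with hω
  let D : ℝ≥0∞ := C * (2 : ℝ≥0∞) ^ (3 * (ω - α))
  have hD : D ≠ ∞ := ENNReal.mul_ne_top ENNReal.coe_ne_top (two_rpow_ne_top _)
  refine ⟨D.toNNReal, fun f g F G hF hG l => ?_⟩
  rw [ENNReal.coe_toNNReal hD]
  set X := besovNorm φ α (ENNReal.ofReal p) 1 f with hX
  set Y := besovNorm φ β (ENNReal.ofReal q) ∞ g with hY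
  have hy : eLpNorm (G l) (ENNReal.ofReal q) volume ≤ (2 : ℝ≥0∞) ^ (-((l : ℝ) * β)) * Y := by
    refine le_two_rpow_neg_mul ?_
    rw [← hG.lpNorm_eq]
    exact le_besovNorm_top l
  -- As ω - α ≥ 0, 2^{k(ω-α)} is at most its value at k = l + 3. What remains is the ℓ^1 sum for f,
  -- so the endpoint α = ω is allowed.
  have key : ∀ k : ℤ,
      (if k ≤ l + 3 then eLpNorm (fun x => F k x * G l x) 2 volume else 0) ≤
      (D * (2 : ℝ≥0∞) ^ ((l : ℝ) * (ω - α - β)) * Y) *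
        ((2 : ℝ≥0∞) ^ ((k : ℝ) * α) * lpNorm (ENNReal.ofReal p) (dyadicBlock φ k f)) := by
    intro k
    split_ifs with hk
    · refine (hC f g F G hF hG k l).trans ?_
      rw [hF.lpNorm_eq]
      set x := eLpNorm (F k) (ENNReal.ofReal p) volume
      calc C * ((2 : ℝ≥0∞) ^ ((k : ℝ) * ω) * x * eLpNorm (G l) (ENNReal.ofReal q) volume)
          ≤ C * ((2 : ℝ≥0∞) ^ (3 * (ω - α) + (l : ℝ) * (ω - α) + (k : ℝ) * α) * x *
            ((2 : ℝ≥0∞) ^ (-((l : ℝ) * β)) * Y)) := by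
            gcongr
            · norm_num
            · have : (k : ℝ) ≤ l + 3 := by exact_mod_cast hk
              nlinarith
        _ = _ := by
            have e : (2 : ℝ≥0∞) ^ ((l : ℝ) * (ω - α - β)) =
                (2 : ℝ≥0∞) ^ ((l : ℝ) * (ω - α)) * (2 : ℝ≥0∞) ^ (-((l : ℝ) * β)) := by
              rw [← two_rpow_add]
              congr 1
              ring
            rw [e, two_rpow_add, two_rpow_add]
            simp only [D]
            ring
    · exact zero_le
  refine (ENNReal.tsum_le_tsum key).trans (le_of_eq ?_)
  rw [ENNReal.tsum_mul_left, ← besovNorm_one, ← hX]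
  ring

theorem exists_tsum_geometric_le {n : ℝ} (hn : 0 < n) :
    ∃ C : ℝ≥0, ∀ k : ℤ, ∑' l : ℤ, (if l ≤ k + 3 then (2 : ℝ≥0∞) ^ ((l : ℝ) * n) else 0) ≤
      C * (2 : ℝ≥0∞) ^ ((k : ℝ) * n) := by
  have hS := tsum_two_rpow_neg_abs_ne_top hn
  set S := ∑' l : ℤ, (2 : ℝ≥0∞) ^ (-(|(l : ℝ)| * n)) with hS_def
  have hD : (2 : ℝ≥0∞) ^ (6 * n) * S ≠ ∞ := ENNReal.mul_ne_top (two_rpow_ne_top _) hS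
  refine ⟨((2 : ℝ≥0∞) ^ (6 * n) * S).toNNReal, fun k => ?_⟩
  rw [ENNReal.coe_toNNReal hD, hS_def, ← (Equiv.subRight k).tsum_eq fun l : ℤ => (2 : ℝ≥0∞) ^ (-(|(l : ℝ)| * n)),
    ← ENNReal.tsum_mul_left, ← ENNReal.tsum_mul_right]
  refine ENNReal.tsum_le_tsum fun l => ?_
  split_ifs with hl
  · rw [← two_rpow_add, ← two_rpow_add]
    refine two_rpow_mono ?_
    have hl' : (l : ℝ) ≤ k + 3 := by exact_mod_cast hl
    -- On l - k ≤ 3 the signed distance k - l loses at most 6 against |l - k|, so the one-sided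
    -- series is dominated by the two-sided one recentred at k.
    have : |(((Equiv.subRight k) l : ℤ) : ℝ)| ≤ 6 + (k - l) := by
      simp only [Equiv.subRight_apply, Int.cast_sub]
      rw [abs_le]
      constructor <;> linarith
    nlinarith
  · exact zero_le

/-- The sum that controls the paraproduct `T_g f`. -/
theorem exists_tsum_high_le (hφ : IsDyadicGenerator φ) (hp : 2 ≤ p) (hq : 2 ≤ q)
    (hpq : 2⁻¹ ≤ p⁻¹ + q⁻¹) (hβ : β < N * (p⁻¹ + q⁻¹ - 2⁻¹)) :
    ∃ C : ℝ≥0, ∀ (f g : 𝓢'(RN N, ℂ)) (F G : ℤ → RN N → ℂ), IsBlockFamily φ p f F →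
      IsBlockFamily φ q g G → ∀ k : ℤ,
      ∑' l : ℤ, (if l ≤ k + 3 then eLpNorm (fun x => F k x * G l x) 2 volume else 0) ≤
        C * (besovNorm φ α (ENNReal.ofReal p) 1 f * besovNorm φ β (ENNReal.ofReal q) ∞ g) *
          (2 : ℝ≥0∞) ^ ((k : ℝ) * (N * (p⁻¹ + q⁻¹ - 2⁻¹) - β - α)) := by
  -- The roles are exchanged: Bernstein is now applied to the blocks of g, which carry the lower
  -- frequency.
  obtain ⟨C, hC⟩ := exists_eLpNorm_mul_two_le hφ hq hp (by rwa [add_comm])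
  rw [add_comm q⁻¹ p⁻¹] at hC
  set ω := N * (p⁻¹ + q⁻¹ - 2⁻¹) with hω
  obtain ⟨S, hS⟩ := exists_tsum_geometric_le (n := ω - β) (by linarith)
  refine ⟨C * S, fun f g F G hF hG k => ?_⟩
  rw [ENNReal.coe_mul]
  set X := besovNorm φ α (ENNReal.ofReal p) 1 f with hX
  set Y := besovNorm φ β (ENNReal.ofReal q) ∞ g with hY
  have hx : eLpNorm (F k) (ENNReal.ofReal p) volume ≤ (2 : ℝ≥0∞) ^ (-((k : ℝ) * α)) * X := by
    refine le_two_rpow_neg_mul ?_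
    rw [← hF.lpNorm_eq, hX, besovNorm_one]
    exact ENNReal.le_tsum k
  have key : ∀ l : ℤ,
      (if l ≤ k + 3 then eLpNorm (fun x => F k x * G l x) 2 volume else 0) ≤
      (C * ((2 : ℝ≥0∞) ^ (-((k : ℝ) * α)) * X) * Y) *
        (if l ≤ k + 3 then (2 : ℝ≥0∞) ^ ((l : ℝ) * (ω - β)) else 0) := by
    intro l
    split_ifs with hk
    · have hy : eLpNorm (G l) (ENNReal.ofReal q) volume ≤ (2 : ℝ≥0∞) ^ (-((l : ℝ) * β)) * Y := by
        refine le_two_rpow_neg_mul ?_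
        rw [← hG.lpNorm_eq]
        exact le_besovNorm_top l
      have h1 := hC g f G F hG hF l k
      simp only [mul_comm (G l _)] at h1
      refine h1.trans ?_
      calc _ ≤ C * ((2 : ℝ≥0∞) ^ ((l : ℝ) * ω) * ((2 : ℝ≥0∞) ^ (-((l : ℝ) * β)) * Y) *
            ((2 : ℝ≥0∞) ^ (-((k : ℝ) * α)) * X)) := by gcongr
        _ = _ := by
            have e : (2 : ℝ≥0∞) ^ ((l : ℝ) * (ω - β)) =
                (2 : ℝ≥0∞) ^ ((l : ℝ) * ω) * (2 : ℝ≥0∞) ^ (-((l : ℝ) * β)) := by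
              rw [← two_rpow_add]
              congr 1
              ring
            rw [e]
            ring
    · exact zero_le
  refine (ENNReal.tsum_le_tsum key).trans ?_
  rw [ENNReal.tsum_mul_left]
  calc _ ≤ (C * ((2 : ℝ≥0∞) ^ (-((k : ℝ) * α)) * X) * Y) *
        (S * (2 : ℝ≥0∞) ^ ((k : ℝ) * (ω - β))) := by
          gcongr
          exact hS k
    _ = _ := by
      have e : (2 : ℝ≥0∞) ^ ((k : ℝ) * (ω - β - α)) =
          (2 : ℝ≥0∞) ^ ((k : ℝ) * (ω - β)) * (2 : ℝ≥0∞) ^ (-((k : ℝ) * α)) := by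
        rw [← two_rpow_add]
        congr 1
        ring
      rw [e]
      ring

/-- The sum that controls the remainder `R(f, g)`. -/
theorem exists_tsum_diag_le (hp : 0 < p) (hq : 0 < q) (hαβ : 0 ≤ α + β) :
    ∃ C : ℝ≥0, ∀ (f g : 𝓢'(RN N, ℂ)) (F G : ℤ → RN N → ℂ), IsBlockFamily φ p f F →
      IsBlockFamily φ q g G → ∀ j : ℤ,
      ∑' z : ℤ × ℤ, (if |z.1 - z.2| ≤ 3 ∧ j ≤ z.2 + 5 then
        eLpNorm (fun x => F z.1 x * G z.2 x) (ENNReal.ofReal (p⁻¹ + q⁻¹)⁻¹) volume else 0) ≤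
        C * (besovNorm φ α (ENNReal.ofReal p) 1 f * besovNorm φ β (ENNReal.ofReal q) ∞ g) *
          (2 : ℝ≥0∞) ^ (-((j : ℝ) * (α + β))) := by
  -- Seven indices l lie within 3 of k. Replacing 2^{-lβ} by 2^{-kβ} costs 2^{3|β|}, and j ≤ l + 5 ≤
  -- k + 8 turns 2^{-k(α+β)} into 2^{(8-j)(α+β)}.
  let D : ℝ≥0∞ := 7 * (2 : ℝ≥0∞) ^ (8 * (α + β) + 3 * |β|)
  have hD : D ≠ ∞ := ENNReal.mul_ne_top (by norm_num) (two_rpow_ne_top _)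
  refine ⟨D.toNNReal, fun f g F G hF hG j => ?_⟩
  rw [ENNReal.coe_toNNReal hD]
  set X := besovNorm φ α (ENNReal.ofReal p) 1 f with hX
  set Y := besovNorm φ β (ENNReal.ofReal q) ∞ g with hY
  rw [ENNReal.tsum_prod (f := fun k l => if |k - l| ≤ 3 ∧ j ≤ l + 5 then
        eLpNorm (fun x => F k x * G l x) (ENNReal.ofReal (p⁻¹ + q⁻¹)⁻¹) volume else 0)]
  have key : ∀ k : ℤ, ∑' l : ℤ, (if |k - l| ≤ 3 ∧ j ≤ l + 5 then
        eLpNorm (fun x => F k x * G l x) (ENNReal.ofReal (p⁻¹ + q⁻¹)⁻¹) volume else 0) ≤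
      (D * (2 : ℝ≥0∞) ^ (-((j : ℝ) * (α + β))) * Y) *
        ((2 : ℝ≥0∞) ^ ((k : ℝ) * α) * lpNorm (ENNReal.ofReal p) (dyadicBlock φ k f)) := by
    intro k
    rw [hF.lpNorm_eq]
    set x := eLpNorm (F k) (ENNReal.ofReal p) volume with hx
    have := tsum_window_le (x := fun l : ℤ => if j ≤ l + 5 then
        eLpNorm (fun x => F k x * G l x) (ENNReal.ofReal (p⁻¹ + q⁻¹)⁻¹) volume else 0)
      (c := (2 : ℝ≥0∞) ^ (8 * (α + β) + 3 * |β|) * (2 : ℝ≥0∞) ^ (-((j : ℝ) * (α + β))) * Y *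
        ((2 : ℝ≥0∞) ^ ((k : ℝ) * α) * x)) k 3 ?_
    · simp only [ite_and]
      refine this.trans (le_of_eq ?_)
      simp only [D]
      push_cast
      ring
    · intro l hl
      split_ifs with hj
      · refine (eLpNorm_mul_le_of_inv_add_inv hp hq (hF.memLp k).1 (hG.memLp l).1).trans ?_
        have hy : eLpNorm (G l) (ENNReal.ofReal q) volume ≤
            (2 : ℝ≥0∞) ^ (-((l : ℝ) * β)) * Y := by
          refine le_two_rpow_neg_mul ?_
          rw [← hG.lpNorm_eq]
          exact le_besovNorm_top l
        calc x * eLpNorm (G l) (ENNReal.ofReal q) volume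
            ≤ x * ((2 : ℝ≥0∞) ^ (-((l : ℝ) * β)) * Y) := by gcongr
          _ ≤ x * ((2 : ℝ≥0∞) ^
              (8 * (α + β) + 3 * |β| + -((j : ℝ) * (α + β)) + (k : ℝ) * α) * Y) := by
              gcongr
              · norm_num
              have hkl : |(k : ℝ) - l| ≤ 3 := by exact_mod_cast hl
              have hjl : (j : ℝ) ≤ l + 5 := by exact_mod_cast hj
              have h1 : ((k : ℝ) - l) * β ≤ 3 * |β| := by
                refine (le_abs_self _).trans ?_
                rw [abs_mul]
                gcongr
              have h2 : (j : ℝ) ≤ k + 8 := by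
                have := (abs_le.1 hkl).1
                linarith
              nlinarith
          _ = _ := by
              rw [two_rpow_add, two_rpow_add]
              ring
      · exact zero_le
  refine (ENNReal.tsum_le_tsum key).trans (le_of_eq ?_)
  rw [ENNReal.tsum_mul_left, ← besovNorm_one, ← hX]
  ring

end Estimates

/-! ### Block bounds from Besov norms -/

section ProductEstimates

variable {N : ℕ} {φ : 𝓢(RN N, ℂ)} {p q α β β' σ τ : ℝ}

/-- The product of `f ∈ Ḃ^α_{p,1}` with `g ∈ Ḃ^β_{q,∞} ∩ Ḃ^{β'}_{q,∞}`, block by block. -/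
theorem exists_product_estimate (hφ : IsDyadicGenerator φ) (hp : 2 ≤ p) (hq : 2 ≤ q)
    (hpq : 2⁻¹ ≤ p⁻¹ + q⁻¹) (hα : α ≤ N * (p⁻¹ + q⁻¹ - 2⁻¹)) (hβ' : β' < N * (p⁻¹ + q⁻¹ - 2⁻¹))
    (hαβ : 0 ≤ α + β) (hσ : σ = N * (p⁻¹ + q⁻¹ - 2⁻¹) - α - β)
    (hτ : τ = N * (p⁻¹ + q⁻¹ - 2⁻¹) - β' - α) (hσN : -((N : ℝ) / 2) < σ) (hστ : σ ≤ τ) :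
    ∃ C : ℝ≥0, ∀ f g : 𝓢'(RN N, ℂ), MemBesov φ α (ENNReal.ofReal p) 1 f →
      MemBesov φ β (ENNReal.ofReal q) ∞ g → MemBesov φ β' (ENNReal.ofReal q) ∞ g →
      ∃ w, IsProduct φ f g w ∧ ∀ j : ℤ, lpNorm 2 (dyadicBlock φ j w) ≤
        C * (besovNorm φ α (ENNReal.ofReal p) 1 f * besovNorm φ β (ENNReal.ofReal q) ∞ g) *
          (2 : ℝ≥0∞) ^ ((j : ℝ) * σ) +
        C * (besovNorm φ α (ENNReal.ofReal p) 1 f * besovNorm φ β' (ENNReal.ofReal q) ∞ g) *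
          (2 : ℝ≥0∞) ^ ((j : ℝ) * τ) := by
  have hp0 : 0 < p := by linarith
  have hq0 : 0 < q := by linarith
  have hp2 : p⁻¹ ≤ 2⁻¹ := inv_anti₀ (by norm_num) hp
  have hq2 : q⁻¹ ≤ 2⁻¹ := inv_anti₀ (by norm_num) hq
  obtain ⟨C, hC⟩ := exists_product_bound (φ := φ) (a := p) (b := q) (r := (p⁻¹ + q⁻¹)⁻¹) hφ
    (by linarith) (by linarith) ((one_le_inv₀ (by positivity)).2 (by linarith))
    (inv_le_of_inv_le₀ (by norm_num) hpq) hσN hστ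
  obtain ⟨C₁, h₁⟩ := exists_tsum_low_le (β := β) hφ hp hq hpq hα
  obtain ⟨C₂, h₂⟩ := exists_tsum_high_le (α := α) hφ hp hq hpq hβ'
  obtain ⟨C₃, h₃⟩ := exists_tsum_diag_le (N := N) (φ := φ) hp0 hq0 hαβ
  refine ⟨C * (C₁ + C₂ + C₃), fun f g hf hg hg' => ?_⟩
  obtain ⟨F, hF⟩ := exists_isBlockFamily hf fun k => by
    rw [besovNorm_one]
    exact ENNReal.le_tsum k
  obtain ⟨G, hG⟩ := exists_isBlockFamily hg le_besovNorm_top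
  rw [MemBesov] at hf hg hg'
  set X := besovNorm φ α (ENNReal.ofReal p) 1 f
  set Y := besovNorm φ β (ENNReal.ofReal q) ∞ g
  set Y' := besovNorm φ β' (ENNReal.ofReal q) ∞ g
  obtain ⟨w, hw, hb⟩ := hC f g F G (C₁ * (X * Y)) (C₂ * (X * Y')) (C₃ * (X * Y)) hF hG
    { low := by
        rw [hσ]
        exact h₁ f g F G hF hG
      high := by
        rw [hτ]
        exact h₂ f g F G hF hG
      diag := by
        intro j
        refine (h₃ f g F G hF hG j).trans (le_of_eq ?_)
        -- For this r, N(1/r - 1/2) is ω itself, so the exponent left is -(α + β).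
        rw [hσ, inv_inv]
        congr 2
        ring
      low_ne_top := by finiteness
      high_ne_top := by finiteness
      diag_ne_top := by finiteness }
  refine ⟨w, hw, fun j => (hb j).trans ?_⟩
  push_cast
  gcongr ?_ * _ + ?_ * _
  · calc (C : ℝ≥0∞) * (C₁ * (X * Y) + C₃ * (X * Y)) = C * (C₁ + C₃) * (X * Y) := by ring
      _ ≤ C * (C₁ + C₂ + C₃) * (X * Y) := by
        gcongr
        exact le_self_add
  · calc (C : ℝ≥0∞) * (C₂ * (X * Y')) = C * C₂ * (X * Y') := by ring
      _ ≤ C * (C₁ + C₂ + C₃) * (X * Y') := by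
        gcongr
        exact le_add_right le_add_self

/-- The square of `f ∈ Ḃ^α_{p,1} ∩ Ḃ^β_{p,∞}`, block by block. -/
theorem exists_square_estimate (hφ : IsDyadicGenerator φ) (hp : 2 ≤ p)
    (hpp : 2⁻¹ ≤ p⁻¹ + p⁻¹) (hα : α ≤ N * (p⁻¹ + p⁻¹ - 2⁻¹))
    (hαβ : 0 ≤ α + β) (hσ : σ = N * (p⁻¹ + p⁻¹ - 2⁻¹) - α - β) (hσN : -((N : ℝ) / 2) < σ) :
    ∃ C : ℝ≥0, ∀ f : 𝓢'(RN N, ℂ), MemBesov φ α (ENNReal.ofReal p) 1 f →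
      MemBesov φ β (ENNReal.ofReal p) ∞ f →
      ∃ w, IsProduct φ f f w ∧ ∀ j : ℤ, lpNorm 2 (dyadicBlock φ j w) ≤
        C * (besovNorm φ α (ENNReal.ofReal p) 1 f * besovNorm φ β (ENNReal.ofReal p) ∞ f) *
          (2 : ℝ≥0∞) ^ ((j : ℝ) * σ) := by
  have hp0 : 0 < p := by linarith
  have hp2 : p⁻¹ ≤ 2⁻¹ := inv_anti₀ (by norm_num) hp
  obtain ⟨C, hC⟩ := exists_product_bound (φ := φ) (a := p) (b := p) (r := (p⁻¹ + p⁻¹)⁻¹) hφ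
    (by linarith) (by linarith) ((one_le_inv₀ (by positivity)).2 (by linarith))
    (inv_le_of_inv_le₀ (by norm_num) hpp) hσN le_rfl
  obtain ⟨C₁, h₁⟩ := exists_tsum_low_le (β := β) hφ hp hp hpp hα
  obtain ⟨C₃, h₃⟩ := exists_tsum_diag_le (N := N) (φ := φ) hp0 hp0 hαβ
  refine ⟨C * (C₁ + C₁ + C₃), fun f hf hg => ?_⟩
  obtain ⟨F, hF⟩ := exists_isBlockFamily hg le_besovNorm_top
  rw [MemBesov] at hf hg
  set X := besovNorm φ α (ENNReal.ofReal p) 1 f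
  set Y := besovNorm φ β (ENNReal.ofReal p) ∞ f
  obtain ⟨w, hw, hb⟩ := hC f f F F (C₁ * (X * Y)) (C₁ * (X * Y)) (C₃ * (X * Y)) hF hF
    { low := by
        rw [hσ]
        exact h₁ f f F F hF hF
      high := by
        -- By symmetry the second paraproduct is the first one again, so β needs no upper bound.
        intro k
        rw [hσ]
        simp only [mul_comm (F k _)]
        exact h₁ f f F F hF hF k
      diag := by
        intro j
        refine (h₃ f f F F hF hF j).trans (le_of_eq ?_)
        rw [hσ, inv_inv]
        congr 2
        ring
      low_ne_top := by finiteness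
      high_ne_top := by finiteness
      diag_ne_top := by finiteness }
  refine ⟨w, hw, fun j => (hb j).trans (le_of_eq ?_)⟩
  push_cast
  ring

end ProductEstimates

/-! ### From block bounds to Besov norms -/

section BesovEstimates

variable {N : ℕ} {φ : 𝓢(RN N, ℂ)} {p α β β' σ τ : ℝ}

theorem mul_two_rpow_le {x y z : ℝ≥0∞} {j : ℤ}
    (h : x ≤ y * (2 : ℝ≥0∞) ^ ((j : ℝ) * σ) + z * (2 : ℝ≥0∞) ^ ((j : ℝ) * τ)) :
    (2 : ℝ≥0∞) ^ ((j : ℝ) * -σ) * x ≤ y + z * (2 : ℝ≥0∞) ^ ((j : ℝ) * (τ - σ)) := by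
  calc _ ≤ (2 : ℝ≥0∞) ^ ((j : ℝ) * -σ) *
        (y * (2 : ℝ≥0∞) ^ ((j : ℝ) * σ) + z * (2 : ℝ≥0∞) ^ ((j : ℝ) * τ)) := by gcongr
    _ = y * (2 : ℝ≥0∞) ^ ((j : ℝ) * -σ + (j : ℝ) * σ) +
        z * (2 : ℝ≥0∞) ^ ((j : ℝ) * -σ + (j : ℝ) * τ) := by
        rw [two_rpow_add, two_rpow_add]
        ring
    _ = _ := by
        rw [show (j : ℝ) * -σ + (j : ℝ) * σ = 0 by ring,
          show (j : ℝ) * -σ + (j : ℝ) * τ = (j : ℝ) * (τ - σ) by ring, ENNReal.rpow_zero, mul_one]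

/-- The low frequencies of a product in `Ḃ^{-σ}_{2,∞}`. -/
theorem exists_low_estimate (hφ : IsDyadicGenerator φ) (hp : 2 ≤ p)
    (hpp : 2⁻¹ ≤ p⁻¹ + p⁻¹) (hα : α ≤ N * (p⁻¹ + p⁻¹ - 2⁻¹)) (hβ' : β' < N * (p⁻¹ + p⁻¹ - 2⁻¹))
    (hαβ : 0 ≤ α + β) (hσ : σ = N * (p⁻¹ + p⁻¹ - 2⁻¹) - α - β)
    (hτ : τ = N * (p⁻¹ + p⁻¹ - 2⁻¹) - β' - α) (hσN : -((N : ℝ) / 2) < σ) (hστ : σ ≤ τ) (k₀ : ℤ) :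
    ∃ C : ℝ≥0, ∀ f g : 𝓢'(RN N, ℂ), MemBesov φ α (ENNReal.ofReal p) 1 f →
      MemBesov φ β (ENNReal.ofReal p) ∞ g → MemBesov φ β' (ENNReal.ofReal p) ∞ g →
      ∃ w, IsProduct φ f g w ∧ besovNormLow φ k₀ (-σ) 2 ∞ w ≤
        C * besovNorm φ α (ENNReal.ofReal p) 1 f *
          (besovNorm φ β (ENNReal.ofReal p) ∞ g + besovNorm φ β' (ENNReal.ofReal p) ∞ g) := by
  obtain ⟨C, hC⟩ := exists_product_estimate hφ hp hp hpp hα hβ' hαβ hσ hτ hσN hστ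
  have hD : (C : ℝ≥0∞) * (1 + (2 : ℝ≥0∞) ^ ((k₀ : ℝ) * (τ - σ))) ≠ ∞ := by finiteness
  refine ⟨((C : ℝ≥0∞) * (1 + (2 : ℝ≥0∞) ^ ((k₀ : ℝ) * (τ - σ)))).toNNReal,
    fun f g hf hg hg' => ?_⟩
  obtain ⟨w, hw, hb⟩ := hC f g hf hg hg'
  refine ⟨w, hw, besovNormLow_top_le fun j hj => (mul_two_rpow_le (hb j)).trans ?_⟩
  rw [ENNReal.coe_toNNReal hD]
  set X := besovNorm φ α (ENNReal.ofReal p) 1 f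
  set Y := besovNorm φ β (ENNReal.ofReal p) ∞ g
  set Y' := besovNorm φ β' (ENNReal.ofReal p) ∞ g
  -- The only use of the low-frequency restriction: τ ≥ σ and j ≤ k₀ absorb the excess power into
  -- the constant.
  have h1 : (2 : ℝ≥0∞) ^ ((j : ℝ) * (τ - σ)) ≤ (2 : ℝ≥0∞) ^ ((k₀ : ℝ) * (τ - σ)) := by
    refine two_rpow_mono (mul_le_mul_of_nonneg_right ?_ (by linarith))
    exact_mod_cast hj
  set T := (2 : ℝ≥0∞) ^ ((k₀ : ℝ) * (τ - σ))
  calc _ ≤ C * (X * Y) + C * (X * Y') * T := by gcongr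
    _ ≤ (C * (X * Y) + C * (X * Y') * T) + (C * (X * Y) * T + C * (X * Y')) := le_self_add
    _ = _ := by ring

/-- The square of a distribution in `Ḃ^{-σ}_{2,∞}`. -/
theorem exists_square_besov_estimate (hφ : IsDyadicGenerator φ) (hp : 2 ≤ p)
    (hpp : 2⁻¹ ≤ p⁻¹ + p⁻¹) (hα : α ≤ N * (p⁻¹ + p⁻¹ - 2⁻¹))
    (hαβ : 0 ≤ α + β) (hσ : σ = N * (p⁻¹ + p⁻¹ - 2⁻¹) - α - β) (hσN : -((N : ℝ) / 2) < σ) :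
    ∃ C : ℝ≥0, ∀ f : 𝓢'(RN N, ℂ), MemBesov φ α (ENNReal.ofReal p) 1 f →
      MemBesov φ β (ENNReal.ofReal p) ∞ f →
      ∃ w, IsProduct φ f f w ∧ besovNorm φ (-σ) 2 ∞ w ≤
        C * besovNorm φ α (ENNReal.ofReal p) 1 f * besovNorm φ β (ENNReal.ofReal p) ∞ f := by
  obtain ⟨C, hC⟩ := exists_square_estimate hφ hp hpp hα hαβ hσ hσN
  refine ⟨C, fun f hf hg => ?_⟩
  obtain ⟨w, hw, hb⟩ := hC f hf hg
  refine ⟨w, hw, besovNorm_top_le fun j => ?_⟩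
  refine (mul_two_rpow_le (z := 0) (τ := 0) (by simpa using hb j)).trans (le_of_eq ?_)
  rw [zero_mul, add_zero, mul_assoc]

end BesovEstimates

end LittlewoodPaley

end

open LittlewoodPaley in
theorem proposition3p4 {N : ℕ} {p σ₁ : ℝ}
    (hp2 : 2 ≤ p) (hpN : p < N) (hp : p ≤ 2 * N / (N - 2))
    (hσ : 1 - (N : ℝ) / 2 < σ₁) (hσ' : σ₁ ≤ 2 * N / p - N / 2)
    (φ : 𝓢(RN N, ℂ)) (hφ : IsDyadicGenerator φ) (k₀ : ℤ) :
    (∃ C : ℝ≥0, ∀ f g : 𝓢'(RN N, ℂ),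
      MemBesov φ (N / p) (ENNReal.ofReal p) 1 f →
      MemBesov φ (-σ₁) 2 ∞ g →
      ∃ fg, IsProduct φ f g fg ∧
        besovNorm φ (-σ₁) 2 ∞ fg ≤
          C * besovNorm φ (N / p) (ENNReal.ofReal p) 1 f * besovNorm φ (-σ₁) 2 ∞ g) ∧
    (∃ C : ℝ≥0, ∀ f g : 𝓢'(RN N, ℂ),
      MemBesov φ (N / p - 1) (ENNReal.ofReal p) 1 f →
      MemBesov φ (-σ₁ + N / p - N / 2 + 1) (ENNReal.ofReal p) ∞ g →
      MemBesov φ (-σ₁ + 2 * N / p - N + 1) (ENNReal.ofReal p) ∞ g →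
      ∃ fg, IsProduct φ f g fg ∧
        besovNormLow φ k₀ (-σ₁) 2 ∞ fg ≤
          C * besovNorm φ (N / p - 1) (ENNReal.ofReal p) 1 f *
            (besovNorm φ (-σ₁ + N / p - N / 2 + 1) (ENNReal.ofReal p) ∞ g +
              besovNorm φ (-σ₁ + 2 * N / p - N + 1) (ENNReal.ofReal p) ∞ g)) ∧
    (∃ C : ℝ≥0, ∀ f g : 𝓢'(RN N, ℂ),
      MemBesov φ (N / p - 2) (ENNReal.ofReal p) 1 f →
      MemBesov φ (-σ₁ + N / p - N / 2 + 2) (ENNReal.ofReal p) ∞ g →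
      MemBesov φ (-σ₁ + 2 * N / p - N + 1) (ENNReal.ofReal p) ∞ g →
      ∃ fg, IsProduct φ f g fg ∧
        besovNormLow φ k₀ (-σ₁) 2 ∞ fg ≤
          C * besovNorm φ (N / p - 2) (ENNReal.ofReal p) 1 f *
            (besovNorm φ (-σ₁ + N / p - N / 2 + 2) (ENNReal.ofReal p) ∞ g +
              besovNorm φ (-σ₁ + 2 * N / p - N + 1) (ENNReal.ofReal p) ∞ g)) ∧
    (∃ C : ℝ≥0, ∀ f : 𝓢'(RN N, ℂ),
      MemBesov φ (N / p - 2) (ENNReal.ofReal p) 1 f →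
      MemBesov φ (-σ₁ + N / p - N / 2 + 2) (ENNReal.ofReal p) ∞ f →
      ∃ ff, IsProduct φ f f ff ∧
        besovNorm φ (-σ₁) 2 ∞ ff ≤
          C * besovNorm φ (N / p - 2) (ENNReal.ofReal p) 1 f *
            besovNorm φ (-σ₁ + N / p - N / 2 + 2) (ENNReal.ofReal p) ∞ f) ∧
    (∃ C : ℝ≥0, ∀ f : 𝓢'(RN N, ℂ),
      MemBesov φ (N / p - 1) (ENNReal.ofReal p) 1 f →
      MemBesov φ (-σ₁ + N / p - N / 2 + 1) (ENNReal.ofReal p) ∞ f →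
      ∃ ff, IsProduct φ f f ff ∧
        besovNorm φ (-σ₁) 2 ∞ ff ≤
          C * besovNorm φ (N / p - 1) (ENNReal.ofReal p) 1 f *
            besovNorm φ (-σ₁ + N / p - N / 2 + 1) (ENNReal.ofReal p) ∞ f) := by
  have hp0 : 0 < p := by linarith
  have hN2 : (2 : ℝ) < N := by linarith
  set P : ℝ := N / p with hP
  have hP' : (N : ℝ) * p⁻¹ = P := by rw [hP, div_eq_mul_inv]
  have e2 : 2 * (N : ℝ) / p = 2 * P := by rw [hP]; ring
  rw [e2] at hσ' ⊢
  have hpN2 : p * (N - 2) ≤ 2 * N := by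
    rwa [le_div_iff₀ (by linarith)] at hp
  have hP1 : 1 < P := (one_lt_div hp0).2 hpN
  have hPN : (N : ℝ) / 2 - 1 ≤ P := by
    rw [hP, le_div_iff₀ hp0]
    linarith
  have hP2 : P ≤ N / 2 := div_le_div_of_nonneg_left (by positivity) (by norm_num) hp2
  -- If p > 4, then 4(N - 2) < 2N gives N < 4, against N > p. The bound p ≤ 4 is what puts a product
  -- of two L^p blocks in L^r with r = p/2 ≤ 2.
  have hp4 : p ≤ 4 := by
    by_contra hcon
    nlinarith
  have hinv : 2⁻¹ ≤ p⁻¹ + p⁻¹ := by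
    have := inv_anti₀ hp0 hp4
    norm_num at this ⊢
    linarith
  have hω : (N : ℝ) * (p⁻¹ + p⁻¹ - 2⁻¹) = 2 * P - N / 2 := by
    rw [← hP']
    ring
  have hσN : -((N : ℝ) / 2) < σ₁ := by linarith
  refine ⟨?_, ?_, ?_, ?_, ?_⟩
  · have hω' : (N : ℝ) * (p⁻¹ + 2⁻¹ - 2⁻¹) = P := by
      rw [← hP']
      ring
    -- With q = 2 one has ω = P, so α = ω is the endpoint case and both paraproducts have exponent
    -- σ₁.
    obtain ⟨C, hC⟩ := exists_product_estimate (α := P) (β := -σ₁) (β' := -σ₁) (σ := σ₁) (τ := σ₁)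
      (q := 2) hφ hp2 le_rfl (by simpa using hp0.le) hω'.ge (by rw [hω']; linarith) (by linarith)
      (by rw [hω']; ring) (by rw [hω']; ring) hσN le_rfl
    simp only [ENNReal.ofReal_ofNat] at hC
    refine ⟨2 * C, fun f g hf hg => ?_⟩
    obtain ⟨w, hw, hb⟩ := hC f g hf hg hg
    refine ⟨w, hw, besovNorm_top_le fun j => ?_⟩
    refine (mul_two_rpow_le (hb j)).trans (le_of_eq ?_)
    rw [sub_self, mul_zero, ENNReal.rpow_zero]
    push_cast
    ring
  -- Here ω = 2P - N/2: α ≤ ω means P ≥ N/2 - 1, β' < ω means σ₁ > 1 - N/2, α + β ≥ 0 means σ₁ ≤ 2P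
  -- - N/2, and τ ≥ σ₁ means P ≤ N/2.
  · exact exists_low_estimate (τ := N / 2 + σ₁ - P) hφ hp2 hinv (by rw [hω]; linarith)
      (by rw [hω]; linarith) (by linarith) (by rw [hω]; ring) (by rw [hω]; ring) hσN
      (by linarith) k₀
  · exact exists_low_estimate (τ := N / 2 + σ₁ - P + 1) hφ hp2 hinv (by rw [hω]; linarith)
      (by rw [hω]; linarith) (by linarith) (by rw [hω]; ring) (by rw [hω]; ring) hσN
      (by linarith) k₀
  · exact exists_square_besov_estimate hφ hp2 hinv (by rw [hω]; linarith) (by linarith)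
      (by rw [hω]; ring) hσN
  · exact exists_square_besov_estimate hφ hp2 hinv (by rw [hω]; linarith) (by linarith)
      (by rw [hω]; ring) hσN
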